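/- Let $G\subseteq SL(n,\mathbb C)$ be a complex affine algebraic group, that is, a Zariski closed subgroup of $SL(n,\mathbb C)$, and let $\theta\colon G\to G$ be an algebraic involution, that is, a group homomorphism given by polynomials in the matrix entries with $\theta\circ\theta=\mathrm{id}_G$. Put $$G_1=\left\{\tfrac12\begin{bmatrix} g+\theta(g) & g-\theta(g)\\ g-\theta(g) & g+\theta(g)\end{bmatrix} : g\in G\right\}\subseteq SL(2n,\mathbb C),$$ and, for $z\in\mathbb C^*$, $$d(z)=\begin{bmatrix} zI&0\\0&I\end{bmatrix}\in GL(2n,\mathbb C),\qquad G_z=d(z^{1/2})\,G_1\,d(z^{-1/2})\subseteq SL(2n,\mathbb C)$$ (this does not depend on the choice of the square root $z^{1/2}$; $z^{-1/2}$ is its inverse). Then the set $$\bigsqcup_{z\in\mathbb C^*}\{z\}\times G_z\subseteq \mathbb C^*\times SL(2n,\mathbb C)$$ is a closed subvariety of the affine variety $\mathbb C^*\times SL(2n,\mathbb C)$ (the common zero set of a set of regular functions), and with its reduced structure, the projection to $\mathbb C^*$ and matrix multiplication in the fibers, it is an algebraic family of groups over $\mathbb C^*$: the projection to $\mathbb C^*$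 is a smooth morphism, and matrix multiplication makes the subvariety a group object in the category of varieties over $\mathbb C^*$. In other words, it is a smooth group scheme over $\mathbb C^*$ whose group law on points with values in any scheme over $\mathbb C^*$ is matrix multiplication. -/

import Mathlib

open scoped LaurentPolynomial MatrixGroups

noncomputable section

namespace GroupFamily

open CategoryTheory AlgebraicGeometry

/-! ### Complex affine algebraic groups inside `SL(n, ℂ)` and their involutions -/

/-- A subgroup of `SL(n, ℂ)` is (Zariski) closed, i.e. is an affine algebraic group embedded in
`SL(n, ℂ)`, if it is cut out by polynomials in the matrix entries. -/
def IsAlgebraicSubgroup {n : ℕ} (G : Subgroup (Matrix.SpecialLinearGroup (Fin n) ℂ)) : Prop :=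
  ∃ S : Set (MvPolynomial (Fin n × Fin n) ℂ), ∀ g : Matrix.SpecialLinearGroup (Fin n) ℂ,
    g ∈ G ↔ ∀ p ∈ S, MvPolynomial.eval (fun ij => g.1 ij.1 ij.2) p = 0

/-- An algebraic involution of `G ⊆ SL(n, ℂ)`: a group endomorphism of order dividing two, which
is a regular map, i.e. is given by polynomials in the matrix entries. -/
structure IsAlgebraicInvolution {n : ℕ} {G : Subgroup (Matrix.SpecialLinearGroup (Fin n) ℂ)}
    (θ : G →* G) : Prop where
  involutive : Function.Involutive θ
  regular : ∃ P : Fin n → Fin n → MvPolynomial (Fin n × Fin n) ℂ, ∀ (g : G) (i j : Fin n),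
    (θ g).1.1 i j = MvPolynomial.eval (fun kl => g.1.1 kl.1 kl.2) (P i j)

/-! ### The groups `G_z` -/

section Fibers

variable {n : ℕ} {G : Subgroup (Matrix.SpecialLinearGroup (Fin n) ℂ)}

/-- The block matrix `½ [g + θ(g), g - θ(g); g - θ(g), g + θ(g)]`. Block matrices of size `2n` are
indexed by `Fin n ⊕ Fin n`. -/
def blockMatrix (θ : G →* G) (g : G) : Matrix (Fin n ⊕ Fin n) (Fin n ⊕ Fin n) ℂ :=
  (1 / 2 : ℂ) • Matrix.fromBlocks (g.1.1 + (θ g).1.1) (g.1.1 - (θ g).1.1)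
    (g.1.1 - (θ g).1.1) (g.1.1 + (θ g).1.1)

/-- `G₁ ⊆ SL(2n, ℂ)`, the image of the embedding `g ↦ ½ [g + θ(g), g - θ(g); g - θ(g), g + θ(g)]`. -/
def fiberOne (θ : G →* G) : Set (Matrix.SpecialLinearGroup (Fin n ⊕ Fin n) ℂ) :=
  {x | ∃ g : G, x.1 = blockMatrix θ g}

/-- The block matrix `d(w) = [w I, 0; 0, I]`. -/
def dMat (n : ℕ) (w : ℂ) : Matrix (Fin n ⊕ Fin n) (Fin n ⊕ Fin n) ℂ :=
  Matrix.fromBlocks (w • 1) 0 0 1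

/-- `G_z = d(z^{1/2}) G₁ d(z^{-1/2})`, for `z ∈ ℂ*`. -/
def fiber (θ : G →* G) (z : ℂˣ) : Set (Matrix.SpecialLinearGroup (Fin n ⊕ Fin n) ℂ) :=
  {x | ∃ y ∈ fiberOne θ,
    x.1 = dMat n ((z : ℂ) ^ (1 / 2 : ℂ)) * y.1 * dMat n ((z : ℂ) ^ (-(1 / 2) : ℂ))}

/-- The disjoint union of the sets `{z} × G_z`, inside `ℂ* × SL(2n, ℂ)`. -/
def totalSet (θ : G →* G) : Set (ℂˣ × Matrix.SpecialLinearGroup (Fin n ⊕ Fin n) ℂ) :=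
  {p | p.2 ∈ fiber θ p.1}

end Fibers

/-! ### The affine variety `ℂ* × SL(m, ℂ)` and its closed subvarieties -/

section Varieties

variable (m : Type) [Fintype m] [DecidableEq m]

/-- The coordinate ring of the affine variety `ℂ* × SL(m, ℂ)`: polynomials in the entries of a
matrix `X`, with coefficients in `ℂ[T, T⁻¹]`, modulo the relation `det X = 1`. -/
def AmbientRing : Type :=
  MvPolynomial (m × m) ℂ[T;T⁻¹] ⧸
    Ideal.span {(Matrix.mvPolynomialX m m ℂ[T;T⁻¹]).det - 1}

instance : CommRing (AmbientRing m) :=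
  inferInstanceAs (CommRing (MvPolynomial (m × m) ℂ[T;T⁻¹] ⧸
    Ideal.span {(Matrix.mvPolynomialX m m ℂ[T;T⁻¹]).det - 1}))

instance : Algebra ℂ[T;T⁻¹] (AmbientRing m) :=
  inferInstanceAs (Algebra ℂ[T;T⁻¹] (MvPolynomial (m × m) ℂ[T;T⁻¹] ⧸
    Ideal.span {(Matrix.mvPolynomialX m m ℂ[T;T⁻¹]).det - 1}))

variable {m}

/-- The quotient map from polynomials to regular functions on `ℂ* × SL(m, ℂ)`. -/
def toAmbient : MvPolynomial (m × m) ℂ[T;T⁻¹] →ₐ[ℂ[T;T⁻¹]] AmbientRing m :=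
  Ideal.Quotient.mkₐ ℂ[T;T⁻¹]
    (Ideal.span {(Matrix.mvPolynomialX m m ℂ[T;T⁻¹]).det - 1})

/-- Evaluation of a polynomial in the matrix entries, with coefficients in `ℂ[T, T⁻¹]`, at a point
`(z, x)` of `ℂ* × SL(m, ℂ)`: `T` goes to `z`, and the variables go to the entries of `x`. -/
def polyEvalAt (p : ℂˣ × Matrix.SpecialLinearGroup m ℂ) :
    MvPolynomial (m × m) ℂ[T;T⁻¹] →+* ℂ :=
  MvPolynomial.eval₂Hom (LaurentPolynomial.eval₂ (RingHom.id ℂ) p.1) (fun ij => p.2.1 ij.1 ij.2)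

theorem polyEvalAt_det (p : ℂˣ × Matrix.SpecialLinearGroup m ℂ) :
    polyEvalAt p ((Matrix.mvPolynomialX m m ℂ[T;T⁻¹]).det - 1) = 0 := by
  rw [map_sub, map_one, RingHom.map_det, RingHom.mapMatrix_apply, polyEvalAt,
    MvPolynomial.coe_eval₂Hom, Matrix.mvPolynomialX_map_eval₂, p.2.2, sub_self]

/-- Evaluation of regular functions at a point `(z, x)` of `ℂ* × SL(m, ℂ)`. -/
def evalAt (p : ℂˣ × Matrix.SpecialLinearGroup m ℂ) : AmbientRing m →+* ℂ :=
  Ideal.Quotient.lift _ (polyEvalAt p) fun a ha => by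
    have h := (Ideal.span_singleton_le_iff_mem (RingHom.ker (polyEvalAt p))).2
      ((RingHom.mem_ker).2 (polyEvalAt_det p))
    exact (RingHom.mem_ker).1 (h ha)

/-- A subset of `ℂ* × SL(m, ℂ)` is a closed subvariety if it is the set of common zeros of a set
of regular functions. -/
def IsClosedSubvariety (E : Set (ℂˣ × Matrix.SpecialLinearGroup m ℂ)) : Prop :=
  ∃ S : Set (AmbientRing m), E = {p | ∀ f ∈ S, evalAt p f = 0}

/-- The ideal of the regular functions on `ℂ* × SL(m, ℂ)` that vanish on `E`. -/
def vanishingIdeal (E : Set (ℂˣ × Matrix.SpecialLinearGroup m ℂ)) : Ideal (AmbientRing m) :=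
  ⨅ p ∈ E, RingHom.ker (evalAt p)

/-- The coordinate ring of (the Zariski closure of) a subset `E` of `ℂ* × SL(m, ℂ)`. -/
abbrev CoordRing (E : Set (ℂˣ × Matrix.SpecialLinearGroup m ℂ)) : Type :=
  AmbientRing m ⧸ vanishingIdeal E

/-- The variety `ℂ*`, as a scheme. -/
abbrev CStar : Scheme.{0} := Spec (CommRingCat.of ℂ[T;T⁻¹])

/-- A closed subvariety `E` of `ℂ* × SL(m, ℂ)`, as a (reduced, affine) scheme over `ℂ*`, the
structure morphism being the projection to `ℂ*`. -/
def asScheme (E : Set (ℂˣ × Matrix.SpecialLinearGroup m ℂ)) : Over CStar :=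
  Over.mk (Spec.map (CommRingCat.ofHom (algebraMap ℂ[T;T⁻¹] (CoordRing E))) :
    Spec (CommRingCat.of (CoordRing E)) ⟶ CStar)

/-- The regular function on `E` that sends a point `(z, x)` to the matrix entry `x i j`. -/
def entry (E : Set (ℂˣ × Matrix.SpecialLinearGroup m ℂ)) (i j : m) : CoordRing E :=
  Ideal.Quotient.mk _ (toAmbient (MvPolynomial.X (i, j)))

/-- The matrix of regular functions on `T` that belongs to a `T`-valued point `T ⟶ E` over `ℂ*`
of a closed subvariety `E` of `ℂ* × SL(m, ℂ)`. -/
def pointMatrix {E : Set (ℂˣ × Matrix.SpecialLinearGroup m ℂ)} {T : Over CStar}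
    (f : T ⟶ asScheme E) : Matrix m m Γ(T.left, ⊤) :=
  Matrix.of fun i j =>
    (show CommRingCat.of (CoordRing E) ⟶ Γ(T.left, ⊤) from
      (Scheme.ΓSpecIso (CommRingCat.of (CoordRing E))).inv ≫ f.left.appTop).hom (entry E i j)

end Varieties

/-! ### Algebraic families of groups -/

/-- An algebraic family of (complex algebraic) groups over a complex variety `X`: a group object
`F` in the category of varieties over `X` (reduced schemes, separated and of finite type over `X`)
such that the morphism `F ⟶ X` is smooth; in other words, a smooth group scheme over `X`. -/
structure IsAlgebraicFamilyOfGroups {X : Scheme.{0}} (F : Over X) [GrpObj F] : Prop where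
  smooth : Smooth F.hom
  separated : IsSeparated F.hom
  locallyOfFiniteType : LocallyOfFiniteType F.hom
  quasiCompact : QuasiCompact F.hom
  reduced : IsReduced F.left

open MonObj in
/-- A closed subvariety `E` of `ℂ* × SL(m, ℂ)` is an algebraic family of groups over `ℂ*`, for the
projection to `ℂ*` and for the group operation of `SL(m, ℂ)` in the fibers: the scheme of `E`
over `ℂ*` has a group structure which makes it an algebraic family of groups and for which the
product of points, with values in any scheme over `ℂ*`, is matrix multiplication. -/
def IsFamilyOfMatrixGroups {m : Type} [Fintype m] [DecidableEq m]
    (E : Set (ℂˣ × Matrix.SpecialLinearGroup m ℂ)) : Prop :=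
  ∃ _ : GrpObj (asScheme E), IsAlgebraicFamilyOfGroups (asScheme E) ∧
    ∀ (T : Over CStar) (f g : T ⟶ asScheme E),
      pointMatrix (f * g) = pointMatrix f * pointMatrix g

end GroupFamily

end

/-! Away from $0$ the family is a twisted form of the constant family with fibre $G$, and it becomes
constant on the double cover $w\mapsto w^2$ of $\mathbb C^*$. Indeed $\tfrac12\begin{bmatrix}
g+\theta(g)&g-\theta(g)\\g-\theta(g)&g+\theta(g)\end{bmatrix}$ is conjugate to
$\mathrm{diag}(g,\theta(g))$ by a constant matrix, so $G_{w^2}$ consists of the conjugates `twist`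
of $\mathrm{diag}(g,\theta(g))$ by a matrix depending only on $w$. The inverse map $x\mapsto
x_{11}+w\,x_{21}$ is algebraic. Replacing $w$ by $-w$ exchanges $g$ and $\theta(g)$, which is the
descent datum.

The argument uses points with values in rings: `IsPoint ρ J M` says that the matrix $M$ solves the
equations $J$. Two principles carry statements about complex points to all rings. By
`eval_eq_zero_of_vanishingIdeal`, a polynomial identity that holds on $G$ holds at every point of
$G$ over a $\mathbb C$-algebra, so these points form groups on which $\theta$ acts. By
`IsPoint.eval₂_eq_zero`, the pullback of the family to the double cover has no equations beyond
those of the family: a function on the cover is $A(w^2)+wB(w^2)$, and the signs $\pm w$ separate $A$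
from $B$. Together they give `IsPoint.twist` and `IsPoint.exists_eq_twist`: over a ring where the
coordinate $T$ is $w^2$ with $w$ a unit, points of the family are exactly the twists of points of
$G$.

Each assertion is then obtained by descent. Closedness is the case of complex points. For the group
law, any ring $K$ embeds in $K[w]/(w^2-t)$, so closure under products and inverses can be tested
there; Yoneda turns the groups of points into a group scheme. For smoothness, $G$ is smooth as a
reduced group scheme of finite type over $\mathbb C$, so its points lift along square-zero
extensions, hence so do points of the family over the cover; smoothness descends because the cover
is faithfully flat. -/

noncomputable section

namespace GroupFamily

open CategoryTheory AlgebraicGeometry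

/-! ### Matrices that satisfy an ideal of polynomial equations -/

section Points

variable {m R K L : Type*} [CommRing R] [CommRing K] [CommRing L]

/-- The entries of a matrix, as a family indexed by pairs. -/
def entries (M : Matrix m m K) (ij : m × m) : K := M ij.1 ij.2

/-- The matrix `M` satisfies all the equations in the ideal `J`, whose coefficients are moved to
the ring of `M` by `c`. -/
def IsPoint (c : R →+* K) (J : Ideal (MvPolynomial (m × m) R)) (M : Matrix m m K) : Prop :=
  ∀ p ∈ J, MvPolynomial.eval₂ c (entries M) p = 0

theorem map_eval₂_entries (f : K →+* L) (c : R →+* K) (M : Matrix m m K)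
    (p : MvPolynomial (m × m) R) :
    f (MvPolynomial.eval₂ c (entries M) p) =
      MvPolynomial.eval₂ (f.comp c) (entries (M.map f)) p :=
  MvPolynomial.hom_eval₂ _ _ _ _

variable {c : R →+* K} {J : Ideal (MvPolynomial (m × m) R)} {M : Matrix m m K}

theorem IsPoint.map (hM : IsPoint c J M) (f : K →+* L) : IsPoint (f.comp c) J (M.map f) :=
  fun p hp => by rw [← map_eval₂_entries, hM p hp, map_zero]

theorem IsPoint.of_map {f : K →+* L} (hf : Function.Injective f)
    (h : IsPoint (f.comp c) J (M.map f)) : IsPoint c J M :=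
  fun p hp => hf (by rw [map_eval₂_entries, h p hp, map_zero])

theorem mvPolynomialX_map_eval_entries (M : Matrix m m K) :
    (Matrix.mvPolynomialX m m K).map (MvPolynomial.eval (entries M)) = M := by
  ext i j
  simp [entries]

theorem map_C_map_eval_entries {a b : Type*} (N : Matrix a b K) (M : Matrix m m K) :
    (N.map MvPolynomial.C).map (MvPolynomial.eval (entries M)) = N := by
  ext i j
  simp

theorem eval_comp_C (M : Matrix m m K) :
    (MvPolynomial.eval (entries M)).comp MvPolynomial.C = RingHom.id K := by
  ext
  simp

end Points

/-- If a polynomial with coefficients in a `k`-algebra vanishes on a set `Z` of points with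
coordinates in the field `k`, then it vanishes at all points, with coordinates in the algebra, of
the Zariski closure of `Z`. -/
theorem eval_eq_zero_of_vanishingIdeal {σ k K : Type*} [Field k] [CommRing K] (c : k →+* K)
    (Z : Set (σ → k)) (x : σ → K)
    (hx : ∀ p ∈ MvPolynomial.vanishingIdeal k Z, MvPolynomial.eval₂ c x p = 0)
    (f : MvPolynomial σ K) (hf : ∀ z ∈ Z, MvPolynomial.eval (fun i => c (z i)) f = 0) :
    MvPolynomial.eval x f = 0 := by
  classical
  let := c.toAlgebra
  have hc : ∀ a : k, c a = algebraMap k K a := fun _ => rfl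
  -- The coefficients of `f` span a finite-dimensional `k`-subspace of `K`. In a basis `b` of it,
  -- `f` is $\sum_i g_i b_i$ with each $g_i$ defined over `k`.
  let V := Submodule.span k (f.coeff '' (f.support : Set (σ →₀ ℕ)))
  have : FiniteDimensional k V :=
    FiniteDimensional.span_of_finite k (f.support.finite_toSet.image _)
  let b := Module.finBasis k V
  have hV : ∀ s ∈ f.support, f.coeff s ∈ V := fun s hs =>
    Submodule.subset_span (Set.mem_image_of_mem _ hs)
  let a : (σ →₀ ℕ) → Fin (Module.finrank k V) → k := fun s i =>
    if h : f.coeff s ∈ V then b.repr ⟨f.coeff s, h⟩ i else 0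
  have ha : ∀ s ∈ f.support, f.coeff s = ∑ i, c (a s i) * (b i : K) := fun s hs => by
    have h := congrArg (Subtype.val : V → K) (b.sum_repr ⟨f.coeff s, hV s hs⟩)
    simp only [AddSubmonoidClass.coe_finsetSum, Submodule.coe_smul, Algebra.smul_def] at h
    rw [← h]
    simp [a, hV s hs, hc]
  let g : Fin (Module.finrank k V) → MvPolynomial σ k := fun i =>
    ∑ s ∈ f.support, MvPolynomial.monomial s (a s i)
  have key : ∀ y : σ → K, MvPolynomial.eval y f = ∑ i, MvPolynomial.eval₂ c y (g i) * (b i : K) := by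
    intro y
    rw [MvPolynomial.eval_eq]
    simp only [g, MvPolynomial.eval₂_sum, MvPolynomial.eval₂_monomial, Finset.sum_mul]
    rw [Finset.sum_comm]
    refine Finset.sum_congr rfl fun s hs => ?_
    rw [ha s hs, Finset.sum_mul]
    refine Finset.sum_congr rfl fun i _ => ?_
    rw [Finsupp.prod]
    ring
  rw [key]
  refine Finset.sum_eq_zero fun i _ => ?_
  rw [hx (g i), zero_mul]
  rw [MvPolynomial.mem_vanishingIdeal_iff]
  intro z hz
  have h := hf z hz
  rw [key] at h
  have h2 : ∀ i, MvPolynomial.eval₂ c (fun i => c (z i)) (g i) = c (MvPolynomial.eval z (g i)) := by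
    intro i
    rw [← MvPolynomial.eval₂_id, MvPolynomial.hom_eval₂, RingHom.comp_id]
  -- At a point of `Z` the values of the $g_i$ lie in `k`, so independence of the basis makes each
  -- one vanish; hence each $g_i$ is in the vanishing ideal.
  have h3 : ∑ i, MvPolynomial.eval z (g i) • b i = 0 := by
    apply Subtype.ext
    simpa [Algebra.smul_def, ← hc, ← h2] using h
  have h4 := Fintype.linearIndependent_iff.1 b.linearIndependent _ h3 i
  rwa [MvPolynomial.aeval_eq_eval]

/-! ### Points of a matrix group with values in an algebra -/

section GroupPoints

variable {n : ℕ} (G : Subgroup (Matrix.SpecialLinearGroup (Fin n) ℂ))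

/-- The ideal of the polynomials in the matrix entries that vanish on `G`. -/
def groupIdeal : Ideal (MvPolynomial (Fin n × Fin n) ℂ) :=
  MvPolynomial.vanishingIdeal ℂ {x | ∃ g ∈ G, x = entries g.1}

theorem mem_groupIdeal {p : MvPolynomial (Fin n × Fin n) ℂ} :
    p ∈ groupIdeal G ↔ ∀ g ∈ G, MvPolynomial.eval (entries g.1) p = 0 := by
  rw [groupIdeal, MvPolynomial.mem_vanishingIdeal_iff]
  refine ⟨fun h g hg => ?_, ?_⟩
  · rw [← MvPolynomial.aeval_eq_eval]
    exact h _ ⟨g, hg, rfl⟩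
  · rintro h _ ⟨g, hg, rfl⟩
    rw [MvPolynomial.aeval_eq_eval]
    exact h g hg

variable {G} {K : Type*} [CommRing K] {c : ℂ →+* K}

theorem isPoint_of_mem (c : ℂ →+* K) {g : Matrix.SpecialLinearGroup (Fin n) ℂ} (hg : g ∈ G) :
    IsPoint c (groupIdeal G) (g.1.map c) := by
  have h : IsPoint (RingHom.id ℂ) (groupIdeal G) g.1 := fun p hp => by
    rw [MvPolynomial.eval₂_id]
    exact (mem_groupIdeal G).1 hp g hg
  simpa using h.map c

variable {M N : Matrix (Fin n) (Fin n) K}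

/-- Two matrices of polynomials that agree on `G` agree at all points of `G`. -/
theorem IsPoint.map_eval_eq (hM : IsPoint c (groupIdeal G) M) {a b : Type*}
    {F F' : Matrix a b (MvPolynomial (Fin n × Fin n) K)}
    (h : ∀ g ∈ G, F.map (MvPolynomial.eval (entries (g.1.map c))) =
      F'.map (MvPolynomial.eval (entries (g.1.map c)))) :
    F.map (MvPolynomial.eval (entries M)) = F'.map (MvPolynomial.eval (entries M)) := by
  ext i j
  simp only [Matrix.map_apply]
  rw [← sub_eq_zero, ← map_sub]
  refine eval_eq_zero_of_vanishingIdeal c _ _ hM _ ?_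
  rintro _ ⟨g, hg, rfl⟩
  have := congrFun (congrFun (h g hg) i) j
  rw [map_sub, sub_eq_zero]
  exact this

theorem IsPoint.eval_eq_zero (hM : IsPoint c (groupIdeal G) M)
    {f : MvPolynomial (Fin n × Fin n) K}
    (h : ∀ g ∈ G, MvPolynomial.eval (entries (g.1.map c)) f = 0) :
    MvPolynomial.eval (entries M) f = 0 := by
  refine eval_eq_zero_of_vanishingIdeal c _ _ hM _ ?_
  rintro _ ⟨g, hg, rfl⟩
  exact h g hg

/-- A matrix of polynomials that sends `G` to solutions of the equations `J` sends the points of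
`G` to solutions of `J`. -/
theorem IsPoint.isPoint_map_eval (hM : IsPoint c (groupIdeal G) M) {m R : Type*} [CommRing R]
    {ρ : R →+* K} {J : Ideal (MvPolynomial (m × m) R)}
    {F : Matrix m m (MvPolynomial (Fin n × Fin n) K)}
    (h : ∀ g ∈ G, IsPoint ρ J (F.map (MvPolynomial.eval (entries (g.1.map c))))) :
    IsPoint ρ J (F.map (MvPolynomial.eval (entries M))) := by
  have hρ : ∀ N : Matrix (Fin n) (Fin n) K,
      (MvPolynomial.eval (entries N)).comp (MvPolynomial.C.comp ρ) = ρ := fun N => by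
    rw [← RingHom.comp_assoc, eval_comp_C, RingHom.id_comp]
  intro p hp
  have h1 := hM.eval_eq_zero (f := MvPolynomial.eval₂ (MvPolynomial.C.comp ρ) (entries F) p)
    fun g hg => by
      rw [map_eval₂_entries, hρ]
      exact h g hg p hp
  rwa [map_eval₂_entries, hρ] at h1

theorem isPoint_one (c : ℂ →+* K) : IsPoint c (groupIdeal G) (1 : Matrix (Fin n) (Fin n) K) := by
  have h := isPoint_of_mem c G.one_mem
  simpa [Matrix.map_one] using h

/-- Closure under products is extended one factor at a time: $h\mapsto hg$ preserves $G$ for fixed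
$g\in G$, which passes to all points $M$ in place of $h$. In `IsPoint.mul`, $M$ is then fixed and
the second factor varies. -/
theorem IsPoint.mul_map_of_mem (hM : IsPoint c (groupIdeal G) M)
    {g : Matrix.SpecialLinearGroup (Fin n) ℂ} (hg : g ∈ G) :
    IsPoint c (groupIdeal G) (M * g.1.map c) := by
  have h := hM.isPoint_map_eval (ρ := c) (J := groupIdeal G)
    (F := Matrix.mvPolynomialX _ _ K * (g.1.map c).map MvPolynomial.C) fun h hh => by
      rw [Matrix.map_mul, mvPolynomialX_map_eval_entries, map_C_map_eval_entries, ← Matrix.map_mul]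
      have hhg := isPoint_of_mem c (G.mul_mem hh hg)
      rwa [Matrix.SpecialLinearGroup.coe_mul] at hhg
  rwa [Matrix.map_mul, mvPolynomialX_map_eval_entries, map_C_map_eval_entries] at h

theorem IsPoint.mul (hM : IsPoint c (groupIdeal G) M) (hN : IsPoint c (groupIdeal G) N) :
    IsPoint c (groupIdeal G) (M * N) := by
  have h := hN.isPoint_map_eval (ρ := c) (J := groupIdeal G)
    (F := M.map MvPolynomial.C * Matrix.mvPolynomialX _ _ K) fun g hg => by
      rw [Matrix.map_mul, mvPolynomialX_map_eval_entries, map_C_map_eval_entries]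
      exact hM.mul_map_of_mem hg
  rwa [Matrix.map_mul, mvPolynomialX_map_eval_entries, map_C_map_eval_entries] at h

theorem adjugate_map_ringHom {m K L : Type*} [Fintype m] [DecidableEq m] [CommRing K] [CommRing L]
    (f : K →+* L) (M : Matrix m m K) : M.adjugate.map f = (M.map f).adjugate :=
  RingHom.map_adjugate f M

/-- The adjugate is a polynomial expression that equals the inverse on determinant one, so the
identity $g^{-1}\in G$ can be propagated from $G$. -/
theorem IsPoint.adjugate (hM : IsPoint c (groupIdeal G) M) :
    IsPoint c (groupIdeal G) M.adjugate := by
  have h := hM.isPoint_map_eval (ρ := c) (J := groupIdeal G)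
    (F := (Matrix.mvPolynomialX _ _ K).adjugate) fun g hg => by
      rw [adjugate_map_ringHom, mvPolynomialX_map_eval_entries, ← adjugate_map_ringHom,
        ← Matrix.SpecialLinearGroup.coe_inv]
      exact isPoint_of_mem c (G.inv_mem hg)
  rwa [adjugate_map_ringHom, mvPolynomialX_map_eval_entries] at h

theorem map_det_matrix {m K L : Type*} [Fintype m] [DecidableEq m] [CommRing K] [CommRing L]
    (f : K →+* L) (M : Matrix m m K) : f M.det = (M.map f).det :=
  RingHom.map_det f M

theorem IsPoint.det_eq_one (hM : IsPoint c (groupIdeal G) M) : M.det = 1 := by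
  have h := hM.eval_eq_zero (f := (Matrix.mvPolynomialX _ _ K).det - 1) fun g hg => by
    have hg1 : g.1.det = 1 := g.2
    rw [map_sub, map_det_matrix, mvPolynomialX_map_eval_entries, ← map_det_matrix, hg1,
      map_one, map_one, sub_self]
  rwa [map_sub, map_det_matrix, mvPolynomialX_map_eval_entries, map_one, sub_eq_zero] at h

theorem IsPoint.adjugate_mul (hM : IsPoint c (groupIdeal G) M) : M.adjugate * M = 1 := by
  rw [Matrix.adjugate_mul, hM.det_eq_one, one_smul]

end GroupPoints

/-! ### Regular maps on the points of a group -/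

section ApplyPoly

variable {n : ℕ}

/-- The matrix whose entries are the values at `M` of the polynomials `P`. -/
def applyPoly {K : Type*} [CommRing K]
    (P : Fin n → Fin n → MvPolynomial (Fin n × Fin n) ℂ) (c : ℂ →+* K)
    (M : Matrix (Fin n) (Fin n) K) : Matrix (Fin n) (Fin n) K :=
  Matrix.of fun i j => MvPolynomial.eval₂ c (entries M) (P i j)

/-- The polynomials `P` represent the map `θ`. -/
def Represents {G : Subgroup (Matrix.SpecialLinearGroup (Fin n) ℂ)}
    (P : Fin n → Fin n → MvPolynomial (Fin n × Fin n) ℂ) (θ : G →* G) : Prop :=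
  ∀ (g : G) (i j : Fin n), (θ g).1.1 i j = MvPolynomial.eval (entries g.1.1) (P i j)

variable {G : Subgroup (Matrix.SpecialLinearGroup (Fin n) ℂ)}
  {P : Fin n → Fin n → MvPolynomial (Fin n × Fin n) ℂ} {θ : G →* G}
  {K L : Type*} [CommRing K] [CommRing L] {c : ℂ →+* K} {M N : Matrix (Fin n) (Fin n) K}

theorem applyPoly_map (f : K →+* L) :
    (applyPoly P c M).map f = applyPoly P (f.comp c) (M.map f) := by
  ext i j
  exact map_eval₂_entries f c M (P i j)

theorem Represents.applyPoly_eq (hP : Represents P θ) (c : ℂ →+* K) (g : G) :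
    applyPoly P c (g.1.1.map c) = (θ g).1.1.map c := by
  have h : applyPoly P (RingHom.id ℂ) g.1.1 = (θ g).1.1 := by
    ext i j
    rw [hP g i j, ← MvPolynomial.eval₂_id]
    rfl
  rw [← h, applyPoly_map, RingHom.comp_id]

theorem applyPoly_C_comp_map_eval (F : Matrix (Fin n) (Fin n) (MvPolynomial (Fin n × Fin n) K)) :
    (applyPoly P (MvPolynomial.C.comp c) F).map (MvPolynomial.eval (entries M)) =
      applyPoly P c (F.map (MvPolynomial.eval (entries M))) := by
  rw [applyPoly_map, ← RingHom.comp_assoc, eval_comp_C, RingHom.id_comp]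

theorem IsPoint.applyPoly (hP : Represents P θ) (hM : IsPoint c (groupIdeal G) M) :
    IsPoint c (groupIdeal G) (applyPoly P c M) := by
  have h := hM.isPoint_map_eval (ρ := c) (J := groupIdeal G)
    (F := GroupFamily.applyPoly P (MvPolynomial.C.comp c) (Matrix.mvPolynomialX _ _ K))
    fun g hg => by
      rw [applyPoly_C_comp_map_eval, mvPolynomialX_map_eval_entries, hP.applyPoly_eq c ⟨g, hg⟩]
      exact isPoint_of_mem c (θ ⟨g, hg⟩).2
  rwa [applyPoly_C_comp_map_eval, mvPolynomialX_map_eval_entries] at h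

theorem Represents.applyPoly_one (hP : Represents P θ) (c : ℂ →+* K) : applyPoly P c 1 = 1 := by
  have h := hP.applyPoly_eq c 1
  simpa [Matrix.map_one] using h

/-- The polynomials `P` are multiplicative only on $G$ itself. As with products, the identity
$\theta(hg)=\theta(h)\theta(g)$ is extended first in $h$, and in `IsPoint.applyPoly_mul` also in
$g$. -/
theorem IsPoint.applyPoly_mul_map (hP : Represents P θ) (hM : IsPoint c (groupIdeal G) M)
    (g : G) : GroupFamily.applyPoly P c (M * g.1.1.map c) =
      GroupFamily.applyPoly P c M * (θ g).1.1.map c := by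
  have h := hM.map_eval_eq
    (F := GroupFamily.applyPoly P (MvPolynomial.C.comp c)
      (Matrix.mvPolynomialX _ _ K * (g.1.1.map c).map MvPolynomial.C))
    (F' := GroupFamily.applyPoly P (MvPolynomial.C.comp c) (Matrix.mvPolynomialX _ _ K) *
      ((θ g).1.1.map c).map MvPolynomial.C) fun h hh => by
        simp only [Matrix.map_mul, applyPoly_C_comp_map_eval, mvPolynomialX_map_eval_entries,
          map_C_map_eval_entries]
        rw [← Matrix.map_mul, hP.applyPoly_eq c ⟨h, hh⟩, ← Matrix.map_mul]
        have := hP.applyPoly_eq c (⟨h, hh⟩ * g)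
        simpa using this
  simpa only [Matrix.map_mul, applyPoly_C_comp_map_eval, mvPolynomialX_map_eval_entries,
    map_C_map_eval_entries] using h

theorem IsPoint.applyPoly_mul (hP : Represents P θ) (hM : IsPoint c (groupIdeal G) M)
    (hN : IsPoint c (groupIdeal G) N) : GroupFamily.applyPoly P c (M * N) =
      GroupFamily.applyPoly P c M * GroupFamily.applyPoly P c N := by
  have h := hN.map_eval_eq
    (F := GroupFamily.applyPoly P (MvPolynomial.C.comp c)
      (M.map MvPolynomial.C * Matrix.mvPolynomialX _ _ K))
    (F' := (GroupFamily.applyPoly P c M).map MvPolynomial.C *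
      GroupFamily.applyPoly P (MvPolynomial.C.comp c) (Matrix.mvPolynomialX _ _ K))
      fun g hg => by
        simp only [Matrix.map_mul, applyPoly_C_comp_map_eval, mvPolynomialX_map_eval_entries,
          map_C_map_eval_entries]
        rw [hM.applyPoly_mul_map hP ⟨g, hg⟩, hP.applyPoly_eq c ⟨g, hg⟩]
  simpa only [Matrix.map_mul, applyPoly_C_comp_map_eval, mvPolynomialX_map_eval_entries,
    map_C_map_eval_entries] using h

end ApplyPoly

/-! ### Twisting a pair of matrices by a unit -/

section Twist

variable {n : ℕ} {K L : Type*} [CommRing K] [CommRing L]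

/-- The base change matrix with blocks `[1, 1; w⁻¹, -w⁻¹]`. -/
def twistLeft (n : ℕ) (w : Kˣ) : Matrix (Fin n ⊕ Fin n) (Fin n ⊕ Fin n) K :=
  Matrix.fromBlocks 1 1 ((w⁻¹ : Kˣ).1 • 1) (-((w⁻¹ : Kˣ).1 • 1))

/-- The inverse of `twistLeft`. -/
def twistRight (n : ℕ) (c : ℂ →+* K) (w : Kˣ) : Matrix (Fin n ⊕ Fin n) (Fin n ⊕ Fin n) K :=
  c (1 / 2) • Matrix.fromBlocks 1 (w.1 • 1) 1 (-(w.1 • 1))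

/-- The conjugate of the block diagonal matrix of `M` and `N` that corresponds to `d(w)` acting on
`½ [M + N, M - N; M - N, M + N]`. -/
def twist (c : ℂ →+* K) (w : Kˣ) (M N : Matrix (Fin n) (Fin n) K) :
    Matrix (Fin n ⊕ Fin n) (Fin n ⊕ Fin n) K :=
  twistLeft n w * Matrix.fromBlocks M 0 0 N * twistRight n c w

theorem map_half_add_map_half (c : ℂ →+* K) : c (1 / 2) + c (1 / 2) = 1 := by
  rw [← map_add, add_halves, map_one]

variable (c : ℂ →+* K) (w : Kˣ) (M N M' N' : Matrix (Fin n) (Fin n) K)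

/-- The factored definition makes products and determinants immediate; this block form serves to
compare with $d(w)$-conjugation and to read off $M$ and $N$. -/
theorem twist_eq : twist c w M N = Matrix.fromBlocks (c (1 / 2) • (M + N))
    (w.1 • c (1 / 2) • (M - N)) ((w⁻¹ : Kˣ).1 • c (1 / 2) • (M - N)) (c (1 / 2) • (M + N)) := by
  rw [twist, twistLeft, twistRight, Matrix.mul_smul, Matrix.fromBlocks_multiply,
    Matrix.fromBlocks_multiply, Matrix.fromBlocks_smul]
  congr 1
  · simp
  · simp [sub_eq_add_neg, smul_smul, mul_comm]
  · simp [sub_eq_add_neg, smul_smul, mul_comm]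
  · simp [smul_smul]

theorem twist_one : twist c w (1 : Matrix (Fin n) (Fin n) K) 1 = 1 := by
  rw [twist_eq, sub_self, smul_zero, smul_zero, smul_zero, smul_add, ← add_smul,
    map_half_add_map_half, one_smul, Matrix.fromBlocks_one]

theorem twistLeft_mul_twistRight : twistLeft n w * twistRight n c w = 1 := by
  rw [← twist_one c w, twist, Matrix.fromBlocks_one, mul_one]

theorem twistRight_mul_twistLeft : twistRight n c w * twistLeft n w = 1 :=
  mul_eq_one_comm.1 (twistLeft_mul_twistRight c w)

theorem twist_mul : twist c w M N * twist c w M' N' = twist c w (M * M') (N * N') := by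
  have h : Matrix.fromBlocks (M * M') 0 0 (N * N') =
      Matrix.fromBlocks M 0 0 N * Matrix.fromBlocks M' 0 0 N' := by
    simp [Matrix.fromBlocks_multiply]
  calc _ = twistLeft n w * Matrix.fromBlocks M 0 0 N * (twistRight n c w * twistLeft n w) *
        Matrix.fromBlocks M' 0 0 N' * twistRight n c w := by simp only [twist, mul_assoc]
    _ = _ := by rw [twistRight_mul_twistLeft, mul_one, twist, h]; simp only [mul_assoc]

theorem det_twist : (twist c w M N).det = M.det * N.det := by
  rw [twist, Matrix.det_mul, Matrix.det_mul, Matrix.det_fromBlocks_zero₂₁, mul_right_comm,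
    ← Matrix.det_mul, twistLeft_mul_twistRight, Matrix.det_one, one_mul]

theorem twist_map (f : K →+* L) : (twist c w M N).map f =
    twist (f.comp c) (Units.map (f : K →* L) w) (M.map f) (N.map f) := by
  have hs : ∀ (a : K) (A : Matrix (Fin n) (Fin n) K), (a • A).map f = f a • A.map f := by
    intro a A
    ext
    simp
  rw [twist_eq, twist_eq, Matrix.fromBlocks_map]
  simp only [hs, Matrix.map_add f (map_add f), Matrix.map_sub f (map_sub f)]
  rfl

/-- The sign of $w$ enters only through the off-diagonal blocks, as does the sign of $M-N$. This
symmetry is what makes $G_z$ independent of the square root. -/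
theorem twist_neg : twist c (-w) M N = twist c w N M := by
  rw [twist_eq, twist_eq, add_comm N M, ← neg_sub M N]
  simp [-neg_sub]

theorem half_smul_add_add_half_smul_sub : c (1 / 2) • (M + N) + c (1 / 2) • (M - N) = M := by
  rw [← smul_add, add_add_sub_cancel, smul_add, ← add_smul, map_half_add_map_half, one_smul]

theorem half_smul_add_sub_half_smul_sub : c (1 / 2) • (M + N) - c (1 / 2) • (M - N) = N := by
  rw [← smul_sub, add_sub_sub_cancel, smul_add, ← add_smul, map_half_add_map_half, one_smul]

end Twist

/-! ### The fibers in terms of an arbitrary square root -/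

section Fiber

variable {n : ℕ} {G : Subgroup (Matrix.SpecialLinearGroup (Fin n) ℂ)} {θ : G →* G}

theorem dMat_mul_blockMatrix_mul_dMat (w : ℂˣ) (g : G) :
    dMat n w * blockMatrix θ g * dMat n (w⁻¹ : ℂˣ) =
      twist (RingHom.id ℂ) w g.1.1 (θ g).1.1 := by
  rw [twist_eq, dMat, dMat, blockMatrix, Matrix.fromBlocks_smul, Matrix.fromBlocks_multiply,
    Matrix.fromBlocks_multiply]
  congr 1
  · simp [smul_smul]
  · simpa using smul_comm _ _ _
  · simp
  · simp

theorem exists_sq_eq (z : ℂˣ) : ∃ w : ℂˣ, w ^ 2 = z ∧ (w : ℂ) = (z : ℂ) ^ (1 / 2 : ℂ) ∧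
    ((w⁻¹ : ℂˣ) : ℂ) = (z : ℂ) ^ (-(1 / 2) : ℂ) := by
  have h : (z : ℂ) ^ (1 / 2 : ℂ) * (z : ℂ) ^ (-(1 / 2) : ℂ) = 1 := by
    rw [← Complex.cpow_add _ _ z.ne_zero, add_neg_cancel, Complex.cpow_zero]
  refine ⟨⟨_, _, h, by rw [mul_comm, h]⟩, ?_, rfl, rfl⟩
  ext
  simp only [Units.val_pow_eq_pow_val]
  rw [← Complex.cpow_nat_mul]
  norm_num

/-- The principal root of $w^2$ is $w$ or $-w$. In the second case `twist_neg` exchanges $g$ and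
$\theta(g)$, and $\theta\circ\theta=\mathrm{id}$ allows $\theta(g)$ to replace $g$. -/
theorem mem_fiber_sq (hθ : Function.Involutive θ) (w : ℂˣ)
    (x : Matrix.SpecialLinearGroup (Fin n ⊕ Fin n) ℂ) :
    x ∈ fiber θ (w ^ 2) ↔ ∃ g : G, x.1 = twist (RingHom.id ℂ) w g.1.1 (θ g).1.1 := by
  obtain ⟨v, hv, hv1, hv2⟩ := exists_sq_eq (w ^ 2)
  have h1 : x ∈ fiber θ (w ^ 2) ↔ ∃ g : G, x.1 = twist (RingHom.id ℂ) v g.1.1 (θ g).1.1 := by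
    constructor
    · rintro ⟨y, ⟨g, hg⟩, hx⟩
      refine ⟨g, ?_⟩
      rw [hx, hg, ← hv1, ← hv2, dMat_mul_blockMatrix_mul_dMat]
    · rintro ⟨g, hx⟩
      have hg1 : g.1.1.det = 1 := g.1.2
      have hg2 : (θ g).1.1.det = 1 := (θ g).1.2
      have h := dMat_mul_blockMatrix_mul_dMat (θ := θ) 1 g
      have hd : dMat n ((1 : ℂˣ) : ℂ) = 1 := by
        rw [dMat, Units.val_one, one_smul, Matrix.fromBlocks_one]
      rw [inv_one, hd, one_mul, mul_one] at h
      refine ⟨⟨blockMatrix θ g, ?_⟩, ⟨g, rfl⟩, ?_⟩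
      · rw [h, det_twist, hg1, hg2, one_mul]
      · rw [hx, ← dMat_mul_blockMatrix_mul_dMat, hv1, hv2]
  rw [h1]
  have h3 : v = w ∨ v = -w := by
    have h2 : (v : ℂ) ^ 2 = (w : ℂ) ^ 2 := by exact_mod_cast congrArg Units.val hv
    exact (sq_eq_sq_iff_eq_or_eq_neg.1 h2).imp Units.ext fun h => Units.ext (by simpa using h)
  obtain rfl | rfl := h3
  · rfl
  · simp only [twist_neg]
    constructor
    · rintro ⟨g, hg⟩
      exact ⟨θ g, by rw [hg, hθ g]⟩
    · rintro ⟨g, hg⟩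
      exact ⟨θ g, by rw [hg, hθ g]⟩

end Fiber

/-! ### The equations of a closed subvariety -/

section Equations

variable {m : Type} [Fintype m] [DecidableEq m]
  (E : Set (ℂˣ × Matrix.SpecialLinearGroup m ℂ))

/-- The restriction to `E` of polynomials in the matrix entries. -/
def coordMap : MvPolynomial (m × m) ℂ[T;T⁻¹] →ₐ[ℂ[T;T⁻¹]] CoordRing E :=
  (Ideal.Quotient.mkₐ ℂ[T;T⁻¹] (vanishingIdeal E)).comp toAmbient

theorem toAmbient_surjective : Function.Surjective (toAmbient (m := m)) :=
  Ideal.Quotient.mk_surjective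

theorem coordMap_surjective : Function.Surjective (coordMap E) :=
  Ideal.Quotient.mk_surjective.comp toAmbient_surjective

theorem mem_vanishingIdeal {f : AmbientRing m} :
    f ∈ vanishingIdeal E ↔ ∀ p ∈ E, evalAt p f = 0 := by
  simp only [vanishingIdeal, Ideal.mem_iInf, RingHom.mem_ker]

/-- The ideal of the polynomials in the matrix entries that vanish on `E`. -/
def equations : Ideal (MvPolynomial (m × m) ℂ[T;T⁻¹]) := RingHom.ker (coordMap E)

theorem mem_equations {f : MvPolynomial (m × m) ℂ[T;T⁻¹]} :
    f ∈ equations E ↔ ∀ p ∈ E, polyEvalAt p f = 0 := by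
  have h : f ∈ equations E ↔ toAmbient f ∈ vanishingIdeal E := by
    rw [equations, RingHom.mem_ker]
    exact Ideal.Quotient.eq_zero_iff_mem
  rw [h, mem_vanishingIdeal]
  rfl

theorem polyEvalAt_eq (p : ℂˣ × Matrix.SpecialLinearGroup m ℂ)
    (f : MvPolynomial (m × m) ℂ[T;T⁻¹]) :
    polyEvalAt p f =
      MvPolynomial.eval₂ (LaurentPolynomial.eval₂ (RingHom.id ℂ) p.1) (entries p.2.1) f := rfl

end Equations

/-! ### Laurent polynomials -/

section Laurent

variable {K L : Type*} [CommRing K] [CommRing L]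

theorem laurent_ringHom_ext {f g : ℂ[T;T⁻¹] →+* K}
    (hC : f.comp LaurentPolynomial.C = g.comp LaurentPolynomial.C)
    (hT : f (LaurentPolynomial.T 1) = g (LaurentPolynomial.T 1)) : f = g := by
  have hT' : f (LaurentPolynomial.T (-1)) = g (LaurentPolynomial.T (-1)) := by
    have h : ∀ φ : ℂ[T;T⁻¹] →+* K,
        φ (LaurentPolynomial.T 1) * φ (LaurentPolynomial.T (-1)) = 1 := fun φ => by
      rw [← map_mul, ← LaurentPolynomial.T_add, add_neg_cancel, LaurentPolynomial.T_zero, map_one]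
    exact left_inv_eq_right_inv (by rw [mul_comm]; exact h f) (by rw [hT]; exact h g)
  refine RingHom.ext fun p => ?_
  induction p using LaurentPolynomial.induction_on with
  | h_C a => exact RingHom.congr_fun hC a
  | h_add hp hq => rw [map_add, map_add, hp, hq]
  | h_C_mul_T n a h =>
    rw [LaurentPolynomial.T_add, ← mul_assoc, map_mul f, map_mul g, h, hT]
  | h_C_mul_T_Z n a h =>
    rw [LaurentPolynomial.T_sub, ← mul_assoc, map_mul f, map_mul g, h, hT']

theorem eval₂_T_one (c : ℂ →+* K) (w : Kˣ) :
    LaurentPolynomial.eval₂ c w (LaurentPolynomial.T 1) = w.1 := by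
  rw [LaurentPolynomial.eval₂_T, zpow_one]

theorem eval₂_comp_C (c : ℂ →+* K) (w : Kˣ) :
    (LaurentPolynomial.eval₂ c w).comp LaurentPolynomial.C = c := by
  ext a
  simp

theorem eq_eval₂ (ρ : ℂ[T;T⁻¹] →+* K) (w : Kˣ) (hw : ρ (LaurentPolynomial.T 1) = w.1) :
    ρ = LaurentPolynomial.eval₂ (ρ.comp LaurentPolynomial.C) w :=
  laurent_ringHom_ext (by rw [eval₂_comp_C]) (by rw [eval₂_T_one, hw])

theorem comp_eval₂ (f : K →+* L) (c : ℂ →+* K) (w : Kˣ) :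
    f.comp (LaurentPolynomial.eval₂ c w) =
      LaurentPolynomial.eval₂ (f.comp c) (Units.map (f : K →* L) w) := by
  refine laurent_ringHom_ext ?_ ?_
  · rw [RingHom.comp_assoc, eval₂_comp_C, eval₂_comp_C]
  · rw [RingHom.comp_apply, eval₂_T_one, eval₂_T_one]
    rfl

/-- The coordinate on `ℂ*`, as a unit. -/
def unitT : (ℂ[T;T⁻¹])ˣ where
  val := LaurentPolynomial.T 1
  inv := LaurentPolynomial.T (-1)
  val_inv := by rw [← LaurentPolynomial.T_add, add_neg_cancel, LaurentPolynomial.T_zero]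
  inv_val := by rw [← LaurentPolynomial.T_add, neg_add_cancel, LaurentPolynomial.T_zero]

/-- A Laurent polynomial that vanishes on `ℂ*` is zero. -/
theorem laurent_eq_zero (p : ℂ[T;T⁻¹])
    (h : ∀ z : ℂˣ, LaurentPolynomial.eval₂ (RingHom.id ℂ) z p = 0) : p = 0 := by
  obtain ⟨n, q, hq⟩ := LaurentPolynomial.exists_T_pow p
  have hq0 : q = 0 := by
    refine Polynomial.eq_zero_of_infinite_isRoot q ((Set.finite_singleton (0 : ℂ)).infinite_compl.mono
      fun z hz => ?_)
    have h1 := congrArg (LaurentPolynomial.eval₂ (RingHom.id ℂ) (Units.mk0 z hz)) hq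
    rw [map_mul, h, zero_mul, LaurentPolynomial.eval₂_toLaurent] at h1
    exact h1
  rw [hq0, map_zero] at hq
  exact ((LaurentPolynomial.isUnit_T (n : ℤ)).mul_left_eq_zero).1 hq.symm

/-- The double cover `w ↦ w²` of `ℂ*`, on regular functions. -/
def sqHom : ℂ[T;T⁻¹] →+* ℂ[T;T⁻¹] := LaurentPolynomial.eval₂ LaurentPolynomial.C (unitT ^ 2)

theorem eval₂_comp_sqHom (c : ℂ →+* K) (w : Kˣ) :
    (LaurentPolynomial.eval₂ c w).comp sqHom = LaurentPolynomial.eval₂ c (w ^ 2) := by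
  rw [sqHom, comp_eval₂, eval₂_comp_C]
  congr 1
  ext
  simp [unitT]

/-- Even powers of $T$ are in the image of `sqHom`, and odd powers are $T$ times even ones. -/
theorem exists_sqHom_add (p : ℂ[T;T⁻¹]) :
    ∃ a b : ℂ[T;T⁻¹], p = sqHom a + LaurentPolynomial.T 1 * sqHom b := by
  induction p using LaurentPolynomial.induction_on' with
  | add p q hp hq =>
    obtain ⟨a, b, rfl⟩ := hp
    obtain ⟨a', b', rfl⟩ := hq
    exact ⟨a + a', b + b', by rw [map_add, map_add]; ring⟩
  | C_mul_T n a =>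
    have h : ∀ k : ℤ, sqHom (LaurentPolynomial.C a * LaurentPolynomial.T k) =
        LaurentPolynomial.C a * LaurentPolynomial.T (k + k) := fun k => by
      have hu : ∀ k : ℤ, ((unitT ^ k : (ℂ[T;T⁻¹])ˣ) : ℂ[T;T⁻¹]) = LaurentPolynomial.T k := by
        intro k
        have := eval₂_comp_C (LaurentPolynomial.C : ℂ →+* ℂ[T;T⁻¹]) unitT
        have h2 : LaurentPolynomial.eval₂ LaurentPolynomial.C unitT = RingHom.id ℂ[T;T⁻¹] :=
          laurent_ringHom_ext (by rw [this, RingHom.id_comp]) (by rw [eval₂_T_one]; rfl)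
        rw [← LaurentPolynomial.eval₂_T LaurentPolynomial.C, h2, RingHom.id_apply]
      rw [sqHom, LaurentPolynomial.eval₂_C_mul_T, ← zpow_natCast, ← zpow_mul, hu]
      congr 2
      push_cast
      ring
    obtain ⟨k, rfl | rfl⟩ := Int.even_or_odd' n
    · exact ⟨LaurentPolynomial.C a * LaurentPolynomial.T k, 0, by rw [h, map_zero]; simp [two_mul]⟩
    · refine ⟨0, LaurentPolynomial.C a * LaurentPolynomial.T k, ?_⟩
      rw [h, map_zero, zero_add, mul_left_comm, ← LaurentPolynomial.T_add]
      congr 2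
      ring

theorem exists_map_sqHom_add {σ : Type*} (F : MvPolynomial σ ℂ[T;T⁻¹]) :
    ∃ A B : MvPolynomial σ ℂ[T;T⁻¹], F = MvPolynomial.map sqHom A +
      MvPolynomial.C (LaurentPolynomial.T 1) * MvPolynomial.map sqHom B := by
  induction F using MvPolynomial.induction_on with
  | C p =>
    obtain ⟨a, b, rfl⟩ := exists_sqHom_add p
    exact ⟨MvPolynomial.C a, MvPolynomial.C b, by
      simp only [MvPolynomial.map_C, map_add, map_mul]⟩
  | add p q hp hq =>
    obtain ⟨a, b, rfl⟩ := hp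
    obtain ⟨a', b', rfl⟩ := hq
    exact ⟨a + a', b + b', by rw [map_add, map_add]; ring⟩
  | mul_X p i hp =>
    obtain ⟨a, b, rfl⟩ := hp
    exact ⟨a * MvPolynomial.X i, b * MvPolynomial.X i, by
      rw [map_mul, map_mul, MvPolynomial.map_X]; ring⟩

end Laurent

/-! ### Points of the family over a base with a square root of the coordinate -/

section DoubleCover

variable {K : Type*} [CommRing K]

theorem eval₂_map_sqHom_add {σ : Type*} (c : ℂ →+* K) (w : Kˣ) (x : σ → K)
    (A B : MvPolynomial σ ℂ[T;T⁻¹]) :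
    MvPolynomial.eval₂ (LaurentPolynomial.eval₂ c w) x (MvPolynomial.map sqHom A +
        MvPolynomial.C (LaurentPolynomial.T 1) * MvPolynomial.map sqHom B) =
      MvPolynomial.eval₂ (LaurentPolynomial.eval₂ c (w ^ 2)) x A +
        w * MvPolynomial.eval₂ (LaurentPolynomial.eval₂ c (w ^ 2)) x B := by
  rw [MvPolynomial.eval₂_add, MvPolynomial.eval₂_mul, MvPolynomial.eval₂_map,
    MvPolynomial.eval₂_map, eval₂_comp_sqHom, MvPolynomial.eval₂_C, eval₂_T_one]

/-- If a function on the double cover `w² = z` of `ℂ* × SL(m, ℂ)` vanishes over `E`, then it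
vanishes at all points of `E` over a ring in which the coordinate of `ℂ*` is a square. -/
theorem IsPoint.eval₂_eq_zero {m : Type} [Fintype m] [DecidableEq m]
    {E : Set (ℂˣ × Matrix.SpecialLinearGroup m ℂ)} {c : ℂ →+* K} {w : Kˣ} {x : Matrix m m K}
    (hx : IsPoint (LaurentPolynomial.eval₂ c (w ^ 2)) (equations E) x)
    (F : MvPolynomial (m × m) ℂ[T;T⁻¹])
    (hF : ∀ (v : ℂˣ) (y : Matrix.SpecialLinearGroup m ℂ), (v ^ 2, y) ∈ E →
      MvPolynomial.eval₂ (LaurentPolynomial.eval₂ (RingHom.id ℂ) v) (entries y.1) F = 0) :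
    MvPolynomial.eval₂ (LaurentPolynomial.eval₂ c w) (entries x) F = 0 := by
  obtain ⟨A, B, rfl⟩ := exists_map_sqHom_add F
  have hAB : ∀ p ∈ E, polyEvalAt p A = 0 ∧ polyEvalAt p B = 0 := by
    rintro ⟨z, y⟩ hp
    obtain ⟨v, rfl, -⟩ := exists_sq_eq z
    have h1 := hF v y hp
    -- The point $-v$ lies over the same $z$. Half the sum and half the difference of the two
    -- equations isolate $A$ and $vB$, and $v$ is invertible.
    have h2 := hF (-v) y (by rwa [neg_sq])
    rw [eval₂_map_sqHom_add] at h1 h2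
    rw [neg_sq, Units.val_neg] at h2
    rw [polyEvalAt_eq, polyEvalAt_eq]
    have h3 : (v : ℂ) * MvPolynomial.eval₂ (LaurentPolynomial.eval₂ (RingHom.id ℂ) (v ^ 2))
        (entries y.1) B = 0 := by linear_combination (h1 - h2) / 2
    exact ⟨by linear_combination (h1 + h2) / 2, by simpa using h3⟩
  rw [eval₂_map_sqHom_add, hx A ((mem_equations E).2 fun p hp => (hAB p hp).1),
    hx B ((mem_equations E).2 fun p hp => (hAB p hp).2), mul_zero, add_zero]

end DoubleCover

/-! ### The pullback of the family to the double cover is constant with fibre `G`. -/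

section Family

variable {n : ℕ} {G : Subgroup (Matrix.SpecialLinearGroup (Fin n) ℂ)}
  {P : Fin n → Fin n → MvPolynomial (Fin n × Fin n) ℂ} {θ : G →* G}
  {K : Type*} [CommRing K] {c : ℂ →+* K}

/-- The universal case is $K=\mathbb C[T,T^{-1}]$ with $w=T$; every other pair $(c,w)$ is a
specialization of it. There each equation gives a Laurent polynomial, which is zero because it
vanishes at every $z\in\mathbb C^*$, its value being the equation at a point of $G_{z^2}$. -/
theorem isPoint_twist_of_mem (hθ : Function.Involutive θ) (c : ℂ →+* K) (w : Kˣ) (g : G) :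
    IsPoint (LaurentPolynomial.eval₂ c (w ^ 2)) (equations (totalSet θ))
      (twist c w (g.1.1.map c) ((θ g).1.1.map c)) := by
  have huniv : IsPoint (LaurentPolynomial.eval₂ LaurentPolynomial.C (unitT ^ 2))
      (equations (totalSet θ)) (twist LaurentPolynomial.C unitT
        (g.1.1.map LaurentPolynomial.C) ((θ g).1.1.map LaurentPolynomial.C)) := by
    intro p hp
    refine laurent_eq_zero _ fun z => ?_
    have hz : Units.map (LaurentPolynomial.eval₂ (RingHom.id ℂ) z : ℂ[T;T⁻¹] →* ℂ) unitT = z :=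
      Units.ext (eval₂_T_one _ _)
    have hC : ∀ A : Matrix (Fin n) (Fin n) ℂ, (A.map LaurentPolynomial.C).map
        (LaurentPolynomial.eval₂ (RingHom.id ℂ) z) = A := fun A => by
      ext
      simp
    have hg1 : g.1.1.det = 1 := g.1.2
    have hg2 : (θ g).1.1.det = 1 := (θ g).1.2
    rw [map_eval₂_entries, comp_eval₂, twist_map, eval₂_comp_C, map_pow, hz, hC, hC]
    refine (mem_equations _).1 hp (z ^ 2, ⟨twist (RingHom.id ℂ) z g.1.1 (θ g).1.1, ?_⟩) ?_
    · rw [det_twist, hg1, hg2, one_mul]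
    · exact (mem_fiber_sq hθ z _).2 ⟨g, rfl⟩
  have hC : ∀ A : Matrix (Fin n) (Fin n) ℂ, (A.map LaurentPolynomial.C).map
      (LaurentPolynomial.eval₂ c w) = A.map c := fun A => by
    ext
    simp
  have hw : Units.map (LaurentPolynomial.eval₂ c w : ℂ[T;T⁻¹] →* K) unitT = w :=
    Units.ext (eval₂_T_one _ _)
  have h := huniv.map (LaurentPolynomial.eval₂ c w)
  rwa [comp_eval₂, twist_map, eval₂_comp_C, map_pow, hw, hC, hC] at h

/-- With $w$ fixed, the twist is polynomial in $M$, so the case $M\in G$ propagates to all points of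
$G$. -/
theorem IsPoint.twist (hθ : Function.Involutive θ) (hP : Represents P θ)
    {M : Matrix (Fin n) (Fin n) K} (hM : IsPoint c (groupIdeal G) M) (w : Kˣ) :
    IsPoint (LaurentPolynomial.eval₂ c (w ^ 2)) (equations (totalSet θ))
      (GroupFamily.twist c w M (GroupFamily.applyPoly P c M)) := by
  have key : ∀ N : Matrix (Fin n) (Fin n) K,
      (GroupFamily.twist (MvPolynomial.C.comp c)
        (Units.map (MvPolynomial.C : K →+* MvPolynomial (Fin n × Fin n) K).toMonoidHom w)
        (Matrix.mvPolynomialX _ _ K)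
        (GroupFamily.applyPoly P (MvPolynomial.C.comp c) (Matrix.mvPolynomialX _ _ K))).map
          (MvPolynomial.eval (entries N)) =
      GroupFamily.twist c w N (GroupFamily.applyPoly P c N) := fun N => by
    rw [twist_map, applyPoly_C_comp_map_eval, mvPolynomialX_map_eval_entries,
      ← RingHom.comp_assoc, eval_comp_C, RingHom.id_comp]
    congr 1
    ext
    simp
  have h := hM.isPoint_map_eval (ρ := LaurentPolynomial.eval₂ c (w ^ 2))
    (J := equations (totalSet θ)) (F := GroupFamily.twist (MvPolynomial.C.comp c)
        (Units.map (MvPolynomial.C : K →+* MvPolynomial (Fin n × Fin n) K).toMonoidHom w)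
        (Matrix.mvPolynomialX _ _ K)
        (GroupFamily.applyPoly P (MvPolynomial.C.comp c) (Matrix.mvPolynomialX _ _ K)))
    fun g hg => by
      rw [key, hP.applyPoly_eq c ⟨g, hg⟩]
      exact isPoint_twist_of_mem hθ c w ⟨g, hg⟩
  rwa [key] at h

/-- The matrix `M` for which `x = twist w M (θ M)`. -/
def untwist (w : K) (x : Matrix (Fin n ⊕ Fin n) (Fin n ⊕ Fin n) K) : Matrix (Fin n) (Fin n) K :=
  x.toBlocks₁₁ + w • x.toBlocks₂₁

theorem untwist_map {L : Type*} [CommRing L] (f : K →+* L) (w : K)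
    (x : Matrix (Fin n ⊕ Fin n) (Fin n ⊕ Fin n) K) :
    (untwist w x).map f = untwist (f w) (x.map f) := by
  ext i j
  simp [untwist, Matrix.toBlocks₁₁, Matrix.toBlocks₂₁]

theorem untwist_twist (c : ℂ →+* K) (w : Kˣ) (M N : Matrix (Fin n) (Fin n) K) :
    untwist w.1 (twist c w M N) = M := by
  rw [untwist, twist_eq, Matrix.toBlocks_fromBlocks₁₁, Matrix.toBlocks_fromBlocks₂₁, smul_smul,
    Units.mul_inv, one_smul, half_smul_add_add_half_smul_sub]

theorem untwist_neg_twist (c : ℂ →+* K) (w : Kˣ) (M N : Matrix (Fin n) (Fin n) K) :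
    untwist (-w.1) (twist c w M N) = N := by
  rw [untwist, twist_eq, Matrix.toBlocks_fromBlocks₁₁, Matrix.toBlocks_fromBlocks₂₁, smul_smul,
    neg_mul, Units.mul_inv, neg_one_smul, ← sub_eq_add_neg, half_smul_add_sub_half_smul_sub]

/-- The two block conditions hold for every twist (`toBlocks_twist`), so they characterize the
matrices of the form `twist c w M N`. -/
theorem twist_untwist (c : ℂ →+* K) (w : Kˣ) (x : Matrix (Fin n ⊕ Fin n) (Fin n ⊕ Fin n) K)
    (h₁ : x.toBlocks₂₂ = x.toBlocks₁₁) (h₂ : x.toBlocks₁₂ = (w.1 * w.1) • x.toBlocks₂₁) :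
    twist c w (untwist w.1 x) (untwist (-w.1) x) = x := by
  have hs : ∀ A : Matrix (Fin n) (Fin n) K, c (1 / 2) • (A + A) = A := fun A => by
    rw [smul_add, ← add_smul, map_half_add_map_half, one_smul]
  have e₁ : untwist w.1 x + untwist (-w.1) x = x.toBlocks₁₁ + x.toBlocks₁₁ := by
    rw [untwist, untwist, neg_smul]
    abel
  have e₂ : untwist w.1 x - untwist (-w.1) x =
      w.1 • x.toBlocks₂₁ + w.1 • x.toBlocks₂₁ := by
    rw [untwist, untwist, neg_smul]
    abel
  rw [twist_eq, e₁, e₂, hs, hs, smul_smul, smul_smul, Units.inv_mul, one_smul, ← h₂]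
  conv_lhs => rw [← h₁]
  conv_rhs => rw [← Matrix.fromBlocks_toBlocks x]
  rw [h₁]

theorem toBlocks_twist (c : ℂ →+* K) (w : Kˣ) (M N : Matrix (Fin n) (Fin n) K) :
    (twist c w M N).toBlocks₂₂ = (twist c w M N).toBlocks₁₁ ∧
    (twist c w M N).toBlocks₁₂ = (w.1 * w.1) • (twist c w M N).toBlocks₂₁ := by
  rw [twist_eq]
  simp only [Matrix.toBlocks_fromBlocks₁₁, Matrix.toBlocks_fromBlocks₁₂,
    Matrix.toBlocks_fromBlocks₂₁, Matrix.toBlocks_fromBlocks₂₂, true_and]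
  rw [smul_smul (w.1 * w.1), mul_assoc, Units.mul_inv, mul_one]

theorem smul_toBlocks₂₁_map {L : Type*} [CommRing L] (f : K →+* L) (a : K)
    (x : Matrix (Fin n ⊕ Fin n) (Fin n ⊕ Fin n) K) :
    (a • x.toBlocks₂₁).map f = f a • (x.map f).toBlocks₂₁ := by
  ext
  simp [Matrix.toBlocks₂₁]

/-- Evaluation of functions on the double cover `w² = z` of `ℂ* × SL(m, ℂ)`. -/
def evalCover {m : Type*} (c : ℂ →+* K) (w : Kˣ) (x : Matrix m m K) :
    MvPolynomial (m × m) ℂ[T;T⁻¹] →+* K :=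
  MvPolynomial.eval₂Hom (LaurentPolynomial.eval₂ c w) (entries x)

theorem mvPolynomialX_map_evalCover {m : Type*} (c : ℂ →+* K) (w : Kˣ) (x : Matrix m m K) :
    (Matrix.mvPolynomialX m m ℂ[T;T⁻¹]).map (evalCover c w x) = x := by
  ext i j
  simp [entries, evalCover]

theorem evalCover_T {m : Type*} (c : ℂ →+* K) (w : Kˣ) (x : Matrix m m K) :
    evalCover c w x (MvPolynomial.C (LaurentPolynomial.T 1)) = w := by
  rw [evalCover, MvPolynomial.coe_eval₂Hom, MvPolynomial.eval₂_C, eval₂_T_one]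

theorem evalCover_comp_C {m : Type*} (c : ℂ →+* K) (w : Kˣ) (x : Matrix m m K) :
    (evalCover c w x).comp (MvPolynomial.C.comp LaurentPolynomial.C) = c := by
  ext
  simp [evalCover]

/-- Two matrices of functions on the double cover that agree over the family agree at all points of
the family over a ring in which the coordinate of `ℂ*` is a square. -/
theorem IsPoint.map_evalCover_eq (hθ : Function.Involutive θ) {w : Kˣ}
    {x : Matrix (Fin n ⊕ Fin n) (Fin n ⊕ Fin n) K}
    (hx : IsPoint (LaurentPolynomial.eval₂ c (w ^ 2)) (equations (totalSet θ)) x) {a b : Type*}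
    (F F' : Matrix a b (MvPolynomial ((Fin n ⊕ Fin n) × (Fin n ⊕ Fin n)) ℂ[T;T⁻¹]))
    (h : ∀ (v : ℂˣ) (g : G),
      F.map (evalCover (RingHom.id ℂ) v
          (GroupFamily.twist (RingHom.id ℂ) v g.1.1 (θ g).1.1)) =
        F'.map (evalCover (RingHom.id ℂ) v
          (GroupFamily.twist (RingHom.id ℂ) v g.1.1 (θ g).1.1))) :
    F.map (evalCover c w x) = F'.map (evalCover c w x) := by
  ext i j
  simp only [Matrix.map_apply]
  rw [← sub_eq_zero, ← map_sub]
  refine hx.eval₂_eq_zero _ fun v y hy => ?_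
  obtain ⟨g, hg⟩ := (mem_fiber_sq hθ v y).1 hy
  rw [hg, MvPolynomial.eval₂_sub, sub_eq_zero]
  exact congrFun (congrFun (h v g) i) j

/-- Over a ring in which the coordinate of `ℂ*` is a square, every point of the family comes from a
point of `G`. -/
theorem IsPoint.exists_eq_twist (hθ : Function.Involutive θ) (hP : Represents P θ) {w : Kˣ}
    {x : Matrix (Fin n ⊕ Fin n) (Fin n ⊕ Fin n) K}
    (hx : IsPoint (LaurentPolynomial.eval₂ c (w ^ 2)) (equations (totalSet θ)) x) :
    ∃ M, IsPoint c (groupIdeal G) M ∧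
      x = GroupFamily.twist c w M (GroupFamily.applyPoly P c M) := by
  let X := Matrix.mvPolynomialX (Fin n ⊕ Fin n) (Fin n ⊕ Fin n) ℂ[T;T⁻¹]
  let W : MvPolynomial ((Fin n ⊕ Fin n) × (Fin n ⊕ Fin n)) ℂ[T;T⁻¹] :=
    MvPolynomial.C (LaurentPolynomial.T 1)
  -- On complex points $x_{11}+wx_{21}$ recovers $g\in G$. The equations of $G$ at this matrix are
  -- therefore functions on the double cover that vanish over the family.
  have hM : IsPoint c (groupIdeal G) (untwist w.1 x) := by
    intro p hp
    have h := hx.eval₂_eq_zero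
      (MvPolynomial.eval₂ (MvPolynomial.C.comp LaurentPolynomial.C) (entries (untwist W X)) p)
      fun v y hy => by
        obtain ⟨g, hg⟩ := (mem_fiber_sq hθ v y).1 hy
        change evalCover (RingHom.id ℂ) v y.1 _ = 0
        rw [map_eval₂_entries, evalCover_comp_C, untwist_map, mvPolynomialX_map_evalCover,
          evalCover_T, hg, untwist_twist, MvPolynomial.eval₂_id]
        exact (mem_groupIdeal G).1 hp g.1 g.2
    change evalCover c w x _ = 0 at h
    rwa [map_eval₂_entries, evalCover_comp_C, untwist_map, mvPolynomialX_map_evalCover,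
      evalCover_T] at h
  have h₁ := hx.map_evalCover_eq hθ X.toBlocks₂₂ X.toBlocks₁₁ fun v g => by
    have h := (toBlocks_twist (RingHom.id ℂ) v g.1.1 (θ g).1.1).1
    rw [← mvPolynomialX_map_evalCover (RingHom.id ℂ) v
      (GroupFamily.twist (RingHom.id ℂ) v g.1.1 (θ g).1.1)] at h
    exact h
  have h₂ := hx.map_evalCover_eq hθ X.toBlocks₁₂ ((W * W) • X.toBlocks₂₁) fun v g => by
    have h := (toBlocks_twist (RingHom.id ℂ) v g.1.1 (θ g).1.1).2
    rw [smul_toBlocks₂₁_map, map_mul, evalCover_T, mvPolynomialX_map_evalCover, ← h]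
    conv_rhs => rw [← mvPolynomialX_map_evalCover (RingHom.id ℂ) v
      (GroupFamily.twist (RingHom.id ℂ) v g.1.1 (θ g).1.1)]
    rfl
  -- Changing $w$ to $-w$ in `untwist` recovers $\theta(g)$ instead of $g$, so this identity says
  -- that the second diagonal factor is $\theta$ of the first.
  have h₃ := hx.map_evalCover_eq hθ
    (GroupFamily.applyPoly P (MvPolynomial.C.comp LaurentPolynomial.C) (untwist W X))
    (untwist (-W) X) fun v g => by
      have h := hP.applyPoly_eq (RingHom.id ℂ) g
      rw [applyPoly_map, evalCover_comp_C, untwist_map, untwist_map, mvPolynomialX_map_evalCover,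
        map_neg, evalCover_T, untwist_twist, untwist_neg_twist]
      simpa using h
  refine ⟨untwist w.1 x, hM, ?_⟩
  rw [applyPoly_map, evalCover_comp_C, untwist_map, untwist_map, mvPolynomialX_map_evalCover,
    map_neg, evalCover_T] at h₃
  rw [smul_toBlocks₂₁_map, map_mul, evalCover_T, mvPolynomialX_map_evalCover] at h₂
  rw [h₃, twist_untwist]
  · rw [← mvPolynomialX_map_evalCover c w x]
    exact h₁
  · rw [← h₂]
    conv_lhs => rw [← mvPolynomialX_map_evalCover c w x]
    rfl

/-- The total space of the family is closed. -/
theorem isClosedSubvariety_totalSet (hG : IsAlgebraicSubgroup G) (hθ : Function.Involutive θ)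
    (hP : Represents P θ) : IsClosedSubvariety (totalSet θ) := by
  -- All functions vanishing on the set are taken as equations; it remains to see that each of their
  -- common zeros is in the set.
  refine ⟨vanishingIdeal (totalSet θ), Set.Subset.antisymm
    (fun p hp f hf => (mem_vanishingIdeal _).1 hf p hp) ?_⟩
  rintro ⟨z, x⟩ hx
  obtain ⟨w, rfl, -⟩ := exists_sq_eq z
  have hpt : IsPoint (LaurentPolynomial.eval₂ (RingHom.id ℂ) (w ^ 2))
      (equations (totalSet θ)) x.1 := fun p hp =>
    hx (toAmbient p) ((mem_vanishingIdeal _).2 ((mem_equations _).1 hp))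
  obtain ⟨M, hM, hMx⟩ := hpt.exists_eq_twist hθ hP
  obtain ⟨S, hS⟩ := hG
  -- Zariski closedness of $G$ enters here: a complex solution of `groupIdeal G` is an element of
  -- $G$.
  have hMG : (⟨M, hM.det_eq_one⟩ : Matrix.SpecialLinearGroup (Fin n) ℂ) ∈ G :=
    (hS _).2 fun p hp => by
      have h := hM p ((mem_groupIdeal G).2 fun g hg => (hS g).1 hg p hp)
      rwa [MvPolynomial.eval₂_id] at h
  refine (mem_fiber_sq hθ w x).2 ⟨⟨_, hMG⟩, ?_⟩
  have h := hP.applyPoly_eq (RingHom.id ℂ) ⟨_, hMG⟩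
  rw [hMx]
  congr 1

theorem isPoint_one_family (hθ : Function.Involutive θ) (hP : Represents P θ) (c : ℂ →+* K)
    (w : Kˣ) :
    IsPoint (LaurentPolynomial.eval₂ c (w ^ 2)) (equations (totalSet θ)) 1 := by
  have h := (isPoint_one (G := G) c).twist hθ hP w
  rwa [hP.applyPoly_one, twist_one] at h

theorem IsPoint.mul_of_sq (hθ : Function.Involutive θ) (hP : Represents P θ) {w : Kˣ}
    {x y : Matrix (Fin n ⊕ Fin n) (Fin n ⊕ Fin n) K}
    (hx : IsPoint (LaurentPolynomial.eval₂ c (w ^ 2)) (equations (totalSet θ)) x)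
    (hy : IsPoint (LaurentPolynomial.eval₂ c (w ^ 2)) (equations (totalSet θ)) y) :
    IsPoint (LaurentPolynomial.eval₂ c (w ^ 2)) (equations (totalSet θ)) (x * y) := by
  obtain ⟨M, hM, rfl⟩ := hx.exists_eq_twist hθ hP
  obtain ⟨N, hN, rfl⟩ := hy.exists_eq_twist hθ hP
  rw [twist_mul, ← hM.applyPoly_mul hP hN]
  exact (hM.mul hN).twist hθ hP w

theorem IsPoint.adjugate_of_sq (hθ : Function.Involutive θ) (hP : Represents P θ) {w : Kˣ}
    {x : Matrix (Fin n ⊕ Fin n) (Fin n ⊕ Fin n) K}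
    (hx : IsPoint (LaurentPolynomial.eval₂ c (w ^ 2)) (equations (totalSet θ)) x) :
    IsPoint (LaurentPolynomial.eval₂ c (w ^ 2)) (equations (totalSet θ)) x.adjugate := by
  obtain ⟨M, hM, rfl⟩ := hx.exists_eq_twist hθ hP
  have hdet : (GroupFamily.twist c w M (GroupFamily.applyPoly P c M)).det = 1 := by
    rw [det_twist, hM.det_eq_one, (hM.applyPoly hP).det_eq_one, one_mul]
  have h : GroupFamily.twist c w M.adjugate (GroupFamily.applyPoly P c M.adjugate) *
      GroupFamily.twist c w M (GroupFamily.applyPoly P c M) = 1 := by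
    rw [twist_mul, ← hM.adjugate.applyPoly_mul hP hM, hM.adjugate_mul, hP.applyPoly_one,
      twist_one]
  have h' : (GroupFamily.twist c w M (GroupFamily.applyPoly P c M)).adjugate =
      GroupFamily.twist c w M.adjugate (GroupFamily.applyPoly P c M.adjugate) :=
    (left_inv_eq_right_inv h (by rw [Matrix.mul_adjugate, hdet, one_smul])).symm
  rw [h']
  exact hM.adjugate.twist hθ hP w

theorem isPoint_family_det_eq_one {ρ : ℂ[T;T⁻¹] →+* K} {m : Type} [Fintype m] [DecidableEq m]
    {E : Set (ℂˣ × Matrix.SpecialLinearGroup m ℂ)} {x : Matrix m m K}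
    (hx : IsPoint ρ (equations E) x) : x.det = 1 := by
  have h := hx ((Matrix.mvPolynomialX m m ℂ[T;T⁻¹]).det - 1)
    ((mem_equations E).2 fun p _ => polyEvalAt_det p)
  have hX : (Matrix.mvPolynomialX m m ℂ[T;T⁻¹]).map
      (MvPolynomial.eval₂Hom ρ (entries x)) = x := by
    ext i j
    simp [entries]
  change MvPolynomial.eval₂Hom ρ (entries x) _ = 0 at h
  rwa [map_sub, map_det_matrix, hX, map_one, sub_eq_zero] at h

end Family

/-! ### Adjoining a square root -/

section SquareRoot

open Polynomial in
/-- The ring obtained from `K` by adjoining a square root of `t`. -/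
abbrev SqrtRing {K : Type*} [CommRing K] (t : K) : Type _ := AdjoinRoot (X ^ 2 - C t : K[X])

variable {K : Type*} [CommRing K]

theorem sqrtRing_monic (t : K) : (Polynomial.X ^ 2 - Polynomial.C t : Polynomial K).Monic :=
  Polynomial.monic_X_pow_sub_C t two_ne_zero

theorem root_sq (t : K) : (AdjoinRoot.root _ : SqrtRing t) ^ 2 = algebraMap K (SqrtRing t) t := by
  have h := AdjoinRoot.eval₂_root (Polynomial.X ^ 2 - Polynomial.C t : Polynomial K)
  rw [Polynomial.eval₂_sub, Polynomial.eval₂_X_pow, Polynomial.eval₂_C, sub_eq_zero] at h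
  exact h

/-- The square root of a unit, as a unit. -/
def rootUnit (t : Kˣ) : (SqrtRing t.1)ˣ where
  val := AdjoinRoot.root _
  inv := AdjoinRoot.root _ * algebraMap K (SqrtRing t.1) (t⁻¹ : Kˣ).1
  val_inv := by rw [← mul_assoc, ← sq, root_sq, ← map_mul, Units.mul_inv, map_one]
  inv_val := by rw [mul_right_comm, ← sq, root_sq, ← map_mul, Units.mul_inv, map_one]

instance (t : K) : Module.Free K (SqrtRing t) := (sqrtRing_monic t).free_adjoinRoot

theorem algebraMap_sqrtRing_injective (t : K) :
    Function.Injective (algebraMap K (SqrtRing t)) := by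
  nontriviality K
  refine (injective_iff_map_eq_zero _).2 fun a ha => ?_
  by_contra h
  have hdvd := AdjoinRoot.mk_eq_zero.1 ((AdjoinRoot.mk_C a).trans ha)
  refine (sqrtRing_monic t).not_dvd_of_degree_lt (Polynomial.C_ne_zero.2 h) ?_ hdvd
  rw [Polynomial.degree_C h, Polynomial.degree_X_pow_sub_C two_pos]
  norm_num

/-- After the square root is adjoined, an arbitrary base point `ρ` of $\mathbb C^*$ factors through
the double cover, so the results for `w ^ 2` apply. -/
theorem comp_algebraMap_sqrtRing (ρ : ℂ[T;T⁻¹] →+* K) :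
    (algebraMap K (SqrtRing (Units.map (ρ : ℂ[T;T⁻¹] →* K) unitT).1)).comp ρ =
      LaurentPolynomial.eval₂ (((algebraMap K _).comp ρ).comp LaurentPolynomial.C)
        (rootUnit (Units.map (ρ : ℂ[T;T⁻¹] →* K) unitT) ^ 2) :=
  eq_eval₂ _ _ (root_sq (Units.map (ρ : ℂ[T;T⁻¹] →* K) unitT).1).symm

end SquareRoot

/-! ### The points of the family form groups -/

section FamilyGroup

variable {n : ℕ} {G : Subgroup (Matrix.SpecialLinearGroup (Fin n) ℂ)}
  {P : Fin n → Fin n → MvPolynomial (Fin n × Fin n) ℂ} {θ : G →* G}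
  {K : Type*} [CommRing K] {ρ : ℂ[T;T⁻¹] →+* K}
  {x y : Matrix (Fin n ⊕ Fin n) (Fin n ⊕ Fin n) K}

/-- Here and in the next two lemmas the equations are tested in `SqrtRing`. Since $K$ embeds in it,
nothing is lost. -/
theorem isPoint_equations_one (hθ : Function.Involutive θ) (hP : Represents P θ)
    (ρ : ℂ[T;T⁻¹] →+* K) : IsPoint ρ (equations (totalSet θ)) 1 := by
  refine .of_map (algebraMap_sqrtRing_injective (Units.map (ρ : ℂ[T;T⁻¹] →* K) unitT).1) ?_
  rw [comp_algebraMap_sqrtRing, Matrix.map_one _ (map_zero _) (map_one _)]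
  exact isPoint_one_family hθ hP _ _

theorem IsPoint.mul_family (hθ : Function.Involutive θ) (hP : Represents P θ)
    (hx : IsPoint ρ (equations (totalSet θ)) x) (hy : IsPoint ρ (equations (totalSet θ)) y) :
    IsPoint ρ (equations (totalSet θ)) (x * y) := by
  have hx' := hx.map (algebraMap K (SqrtRing (Units.map (ρ : ℂ[T;T⁻¹] →* K) unitT).1))
  have hy' := hy.map (algebraMap K (SqrtRing (Units.map (ρ : ℂ[T;T⁻¹] →* K) unitT).1))
  refine .of_map (algebraMap_sqrtRing_injective (Units.map (ρ : ℂ[T;T⁻¹] →* K) unitT).1) ?_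
  rw [comp_algebraMap_sqrtRing] at hx' hy' ⊢
  rw [Matrix.map_mul]
  exact hx'.mul_of_sq hθ hP hy'

theorem IsPoint.adjugate_family (hθ : Function.Involutive θ) (hP : Represents P θ)
    (hx : IsPoint ρ (equations (totalSet θ)) x) :
    IsPoint ρ (equations (totalSet θ)) x.adjugate := by
  have hx' := hx.map (algebraMap K (SqrtRing (Units.map (ρ : ℂ[T;T⁻¹] →* K) unitT).1))
  refine .of_map (algebraMap_sqrtRing_injective (Units.map (ρ : ℂ[T;T⁻¹] →* K) unitT).1) ?_
  rw [comp_algebraMap_sqrtRing] at hx' ⊢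
  rw [adjugate_map_ringHom]
  exact hx'.adjugate_of_sq hθ hP

end FamilyGroup

/-! ### Affine group schemes from groups of matrices -/

section GroupScheme

variable {R A : Type} [CommRing R] [CommRing A] [Algebra R A]

/-- The spectrum of an algebra, as a scheme over the spectrum of the base ring. -/
abbrev specOver (R A : Type) [CommRing R] [CommRing A] [Algebra R A] :
    Over (Spec (CommRingCat.of R)) :=
  Over.mk (Spec.map (CommRingCat.ofHom (algebraMap R A)) :
    Spec (CommRingCat.of A) ⟶ Spec (CommRingCat.of R))

/-- The structure map of the ring of functions on a scheme over `Spec R`. -/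
def structureHom (T : Over (Spec (CommRingCat.of R))) : R →+* Γ(T.left, ⊤) :=
  (show CommRingCat.of R ⟶ Γ(T.left, ⊤) from
    (Scheme.ΓSpecIso (CommRingCat.of R)).inv ≫ T.hom.appTop).hom

/-- The homomorphism from `A` to the functions on `T` that belongs to a morphism `T ⟶ Spec A`. -/
def pointHom {T : Over (Spec (CommRingCat.of R))} (f : T ⟶ specOver R A) : A →+* Γ(T.left, ⊤) :=
  (show CommRingCat.of A ⟶ Γ(T.left, ⊤) from
    (Scheme.ΓSpecIso (CommRingCat.of A)).inv ≫ f.left.appTop).hom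

theorem pointHom_comp_algebraMap {T : Over (Spec (CommRingCat.of R))} (f : T ⟶ specOver R A) :
    (pointHom f).comp (algebraMap R A) = structureHom T := by
  have h : f.left ≫ Spec.map (CommRingCat.ofHom (algebraMap R A)) = T.hom := Over.w f
  have h2 : CommRingCat.ofHom (algebraMap R A) ≫ (Scheme.ΓSpecIso (CommRingCat.of A)).inv ≫
      f.left.appTop = (Scheme.ΓSpecIso (CommRingCat.of R)).inv ≫ T.hom.appTop := by
    rw [← h, Scheme.Hom.comp_appTop, Scheme.ΓSpecIso_inv_naturality_assoc]
  exact congrArg CommRingCat.Hom.hom h2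

theorem pointHom_injective {T : Over (Spec (CommRingCat.of R))} :
    Function.Injective (pointHom (A := A) (T := T)) := by
  intro f g h
  have h2 : (Scheme.ΓSpecIso (CommRingCat.of A)).inv ≫ f.left.appTop =
    (Scheme.ΓSpecIso (CommRingCat.of A)).inv ≫ g.left.appTop := CommRingCat.hom_ext h
  rw [Iso.cancel_iso_inv_left] at h2
  have : IsAffine (specOver R A).left := inferInstanceAs (IsAffine (Spec _))
  exact Over.OverMorphism.ext (ext_of_isAffine h2)

/-- This is the adjunction between global sections and `Spec`. With `pointHom_injective`, it
identifies $T$-points of `Spec A` over `Spec R` with $R$-algebra homomorphisms from $A$ to the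
functions on $T$. -/
theorem exists_pointHom_eq {T : Over (Spec (CommRingCat.of R))} (φ : A →+* Γ(T.left, ⊤))
    (hφ : φ.comp (algebraMap R A) = structureHom T) :
    ∃ f : T ⟶ specOver R A, pointHom f = φ := by
  have h : (T.left.toSpecΓ ≫ Spec.map (CommRingCat.ofHom φ)) ≫
      Spec.map (CommRingCat.ofHom (algebraMap R A)) = T.hom := by
    apply ext_of_isAffine
    rw [← Iso.cancel_iso_inv_left (Scheme.ΓSpecIso (CommRingCat.of R)), Category.assoc,
      ← Spec.map_comp, ← CommRingCat.ofHom_comp, hφ, Scheme.Hom.comp_appTop,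
      ← Scheme.ΓSpecIso_inv_naturality_assoc, Scheme.toSpecΓ_appTop, Iso.inv_hom_id,
      Category.comp_id]
    rfl
  refine ⟨Over.homMk (T.left.toSpecΓ ≫ Spec.map (CommRingCat.ofHom φ)) h, ?_⟩
  have h2 : (Scheme.ΓSpecIso (CommRingCat.of A)).inv ≫
      (T.left.toSpecΓ ≫ Spec.map (CommRingCat.ofHom φ)).appTop = CommRingCat.ofHom φ := by
    rw [Scheme.Hom.comp_appTop, ← Scheme.ΓSpecIso_inv_naturality_assoc, Scheme.toSpecΓ_appTop,
      Iso.inv_hom_id, Category.comp_id]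
  exact congrArg CommRingCat.Hom.hom h2

theorem structureHom_comp {T T' : Over (Spec (CommRingCat.of R))} (t : T' ⟶ T) :
    t.left.appTop.hom.comp (structureHom T) = structureHom T' := by
  have h : (Scheme.ΓSpecIso (CommRingCat.of R)).inv ≫ T'.hom.appTop =
      ((Scheme.ΓSpecIso (CommRingCat.of R)).inv ≫ T.hom.appTop) ≫ t.left.appTop := by
    rw [← Over.w t, Scheme.Hom.comp_appTop, Category.assoc]
  exact (congrArg CommRingCat.Hom.hom h).symm

theorem pointHom_comp {T T' : Over (Spec (CommRingCat.of R))} (t : T' ⟶ T)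
    (f : T ⟶ specOver R A) : pointHom (t ≫ f) = t.left.appTop.hom.comp (pointHom f) := by
  have h : (Scheme.ΓSpecIso (CommRingCat.of A)).inv ≫ (t ≫ f).left.appTop =
      ((Scheme.ΓSpecIso (CommRingCat.of A)).inv ≫ f.left.appTop) ≫ t.left.appTop := by
    rw [Over.comp_left, Scheme.Hom.comp_appTop, Category.assoc]
  exact congrArg CommRingCat.Hom.hom h

/-! ### Homomorphisms from a quotient of a polynomial ring as matrix solutions. -/

section AlgebraPoints

variable {m : Type*} (π : MvPolynomial (m × m) R →ₐ[R] A)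

/-- The matrix of generators of the algebra `A`. -/
def generatorMatrix : Matrix m m A := (Matrix.mvPolynomialX m m R).map π

variable {K : Type*} [CommRing K] {ρ : R →+* K}

theorem comp_eq_eval₂Hom (φ : A →+* K) (hφ : φ.comp (algebraMap R A) = ρ) :
    φ.comp (π : MvPolynomial (m × m) R →+* A) =
      MvPolynomial.eval₂Hom ρ (entries ((generatorMatrix π).map φ)) := by
  refine MvPolynomial.ringHom_ext (fun r => ?_) fun ij => ?_
  · have h : π (MvPolynomial.C r) = algebraMap R A r := π.commutes r
    rw [MvPolynomial.coe_eval₂Hom, MvPolynomial.eval₂_C, ← hφ]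
    simp [h]
  · simp [generatorMatrix, entries]

theorem isPoint_generatorMatrix_map (φ : A →+* K) (hφ : φ.comp (algebraMap R A) = ρ) :
    IsPoint ρ (RingHom.ker π) ((generatorMatrix π).map φ) := by
  intro p hp
  have h := RingHom.congr_fun (comp_eq_eval₂Hom π φ hφ) p
  rw [RingHom.comp_apply, AlgHom.coe_toRingHom, (RingHom.mem_ker).1 hp, map_zero] at h
  exact h.symm

theorem ringHom_ext_generatorMatrix (hπ : Function.Surjective π) {φ ψ : A →+* K}
    (h : φ.comp (algebraMap R A) = ψ.comp (algebraMap R A))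
    (hM : (generatorMatrix π).map φ = (generatorMatrix π).map ψ) : φ = ψ := by
  refine RingHom.cancel_right (f := (π : MvPolynomial (m × m) R →+* A)) hπ |>.1 ?_
  rw [comp_eq_eval₂Hom π φ h, comp_eq_eval₂Hom π ψ rfl, hM]

theorem IsPoint.exists_ringHom (hπ : Function.Surjective π) {M : Matrix m m K}
    (hM : IsPoint ρ (RingHom.ker π) M) :
    ∃ φ : A →+* K, φ.comp (algebraMap R A) = ρ ∧ (generatorMatrix π).map φ = M := by
  have hker : RingHom.ker (π : MvPolynomial (m × m) R →+* A) ≤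
      RingHom.ker (MvPolynomial.eval₂Hom ρ (entries M)) := fun p hp =>
    (RingHom.mem_ker).2 (hM p hp)
  have hlift := RingHom.liftOfRightInverse_comp_apply
    (π : MvPolynomial (m × m) R →+* A) (Function.surjInv hπ) (Function.rightInverse_surjInv hπ)
    ⟨_, hker⟩
  refine ⟨RingHom.liftOfRightInverse (π : MvPolynomial (m × m) R →+* A) (Function.surjInv hπ)
    (Function.rightInverse_surjInv hπ) ⟨_, hker⟩, ?_, ?_⟩
  · ext r
    have h := hlift (MvPolynomial.C r)
    rw [show (π : MvPolynomial (m × m) R →+* A) (MvPolynomial.C r) = algebraMap R A r from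
      π.commutes r] at h
    rw [RingHom.comp_apply, h]
    simp
  · ext i j
    have h := hlift (MvPolynomial.X (i, j))
    simp only [MvPolynomial.coe_eval₂Hom, MvPolynomial.eval₂_X] at h
    simpa [generatorMatrix, entries] using h

end AlgebraPoints

variable {m : Type} [Fintype m] [DecidableEq m]

/-- The solutions of a system of equations form a group of invertible matrices, functorially. -/
structure IsMatrixGroup (J : Ideal (MvPolynomial (m × m) R)) : Prop where
  one : ∀ {K : Type} [CommRing K] (ρ : R →+* K), IsPoint ρ J (1 : Matrix m m K)
  mul : ∀ {K : Type} [CommRing K] {ρ : R →+* K} {M N : Matrix m m K},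
    IsPoint ρ J M → IsPoint ρ J N → IsPoint ρ J (M * N)
  adjugate : ∀ {K : Type} [CommRing K] {ρ : R →+* K} {M : Matrix m m K},
    IsPoint ρ J M → IsPoint ρ J M.adjugate
  det : ∀ {K : Type} [CommRing K] {ρ : R →+* K} {M : Matrix m m K},
    IsPoint ρ J M → M.det = 1

variable {J : Ideal (MvPolynomial (m × m) R)}

/-- The group of solutions of a system of equations. -/
def IsMatrixGroup.points (hJ : IsMatrixGroup J) {K : Type} [CommRing K] (ρ : R →+* K) :
    Subgroup (Matrix.SpecialLinearGroup m K) where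
  carrier := {x | IsPoint ρ J x.1}
  mul_mem' := fun hx hy => by
    have h := hJ.mul hx hy
    rwa [← Matrix.SpecialLinearGroup.coe_mul] at h
  one_mem' := hJ.one ρ
  inv_mem' := fun {x} hx => by
    have h := hJ.adjugate hx
    rwa [← Matrix.SpecialLinearGroup.coe_inv] at h

/-- The functor of points of the group of solutions. -/
def IsMatrixGroup.functor (hJ : IsMatrixGroup J) :
    (Over (Spec (CommRingCat.of R)))ᵒᵖ ⥤ GrpCat.{0} where
  obj T := GrpCat.of (hJ.points (structureHom T.unop))
  map {T T'} t := GrpCat.ofHom (((Matrix.SpecialLinearGroup.map t.unop.left.appTop.hom).comp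
    (hJ.points (structureHom T.unop)).subtype).codRestrict (hJ.points (structureHom T'.unop))
      fun x => by
        have h := IsPoint.map x.2 t.unop.left.appTop.hom
        rwa [structureHom_comp] at h)
  map_id T := by
    ext x i j
    change (𝟙 T.unop : T.unop ⟶ T.unop).left.appTop.hom (x.1.1 i j) = x.1.1 i j
    simp
  map_comp {T T' T''} t t' := by
    ext x i j
    change (t'.unop ≫ t.unop).left.appTop.hom (x.1.1 i j) =
      t'.unop.left.appTop.hom (t.unop.left.appTop.hom (x.1.1 i j))
    rw [Over.comp_left, Scheme.Hom.comp_appTop]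
    rfl

variable (π : MvPolynomial (m × m) R →ₐ[R] A)

/-- The points of `Spec A` are the solutions of the equations that define `A`. -/
def pointsEquiv (hπ : Function.Surjective π) (hJ : IsMatrixGroup (RingHom.ker π))
    (T : Over (Spec (CommRingCat.of R))) :
    (T ⟶ specOver R A) ≃ hJ.points (structureHom T) :=
  Equiv.ofBijective (fun f => ⟨⟨(generatorMatrix π).map (pointHom f),
      hJ.det (isPoint_generatorMatrix_map π _ (pointHom_comp_algebraMap f))⟩,
      isPoint_generatorMatrix_map π _ (pointHom_comp_algebraMap f)⟩) <| by
    constructor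
    · intro f g h
      refine pointHom_injective (ringHom_ext_generatorMatrix π hπ ?_ ?_)
      · rw [pointHom_comp_algebraMap, pointHom_comp_algebraMap]
      · exact congrArg (fun x => x.1.1) h
    · intro x
      obtain ⟨φ, hφ, hM⟩ := IsPoint.exists_ringHom π hπ x.2
      obtain ⟨f, rfl⟩ := exists_pointHom_eq φ hφ
      exact ⟨f, Subtype.ext (Subtype.ext hM)⟩

/-- `Spec A` represents the functor of solutions of the equations that define `A`. -/
def pointsRepresentableBy (hπ : Function.Surjective π) (hJ : IsMatrixGroup (RingHom.ker π)) :
    (hJ.functor ⋙ forget GrpCat).RepresentableBy (specOver R A) where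
  homEquiv {T} := pointsEquiv π hπ hJ T
  homEquiv_comp {T T'} t f := by
    refine Subtype.ext (Subtype.ext ?_)
    ext i j
    change pointHom (t ≫ f) _ = t.left.appTop.hom (pointHom f _)
    rw [pointHom_comp]
    rfl

open MonObj in
/-- If the solutions of the equations that define `A` form groups of matrices, then `Spec A` is a
group scheme, for matrix multiplication. -/
theorem exists_grpObj (hπ : Function.Surjective π) (hJ : IsMatrixGroup (RingHom.ker π)) :
    ∃ _ : GrpObj (specOver R A), ∀ (T : Over (Spec (CommRingCat.of R)))
      (f g : T ⟶ specOver R A), (generatorMatrix π).map (pointHom (f * g)) =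
        (generatorMatrix π).map (pointHom f) * (generatorMatrix π).map (pointHom g) := by
  let α := pointsRepresentableBy π hπ hJ
  -- The group structure comes from Yoneda, so the bijection on points is multiplicative by
  -- construction.
  let i := GrpObj.ofRepresentableBy (specOver R A) hJ.functor α
  refine ⟨i, fun T f g => ?_⟩
  have h : pointsEquiv π hπ hJ T (f * g) = pointsEquiv π hπ hJ T f * pointsEquiv π hπ hJ T g :=
    map_mul ((yonedaGrpObjIsoOfRepresentableBy (specOver R A) hJ.functor α).hom.app
      (Opposite.op T)).hom f g
  exact congrArg (fun x => x.1.1) h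

end GroupScheme

/-! ### Smoothness -/

open MonObj MonoidalCategory CartesianMonoidalCategory in
/-- A reduced group scheme locally of finite type over an algebraically closed field is smooth. -/
theorem smooth_of_grpObj_of_isAlgClosed {K : Type} [Field K] [IsAlgClosed K] {G : Scheme.{0}}
    (f : G ⟶ Spec (.of K)) [LocallyOfFiniteType f] [GrpObj (Over.mk f)] [IsReduced G] :
    Smooth f := by
  have := LocallyOfFiniteType.jacobsonSpace f
  have : Nonempty G := ⟨η[Over.mk f].1 (IsLocalRing.closedPoint _)⟩
  rw [← Scheme.Hom.smoothLocus_eq_top_iff, ← TopologicalSpace.Opens.coe_eq_univ,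
    ← not_ne_iff, ← Set.nonempty_compl]
  -- A nonempty singular locus is closed and contains a closed point $x$. The smooth locus is dense
  -- because the field is perfect, so it contains a closed point $y$. Both are rational points, as
  -- the field is algebraically closed.
  intro H
  obtain ⟨x, hx, hxc⟩ :=
    nonempty_inter_closedPoints H f.smoothLocus.2.isClosed_compl.isLocallyClosed
  obtain ⟨y, hy : y ∈ f.smoothLocus, hyc⟩ := nonempty_inter_closedPoints
    f.dense_smoothLocus_of_perfectField.nonempty f.smoothLocus.2.isLocallyClosed
  let x' : 𝟙_ _ ⟶ Over.mk f := Over.homMk _ ((pointEquivClosedPoint f).symm ⟨x, hxc⟩).2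
  let y' : 𝟙_ _ ⟶ Over.mk f := Over.homMk _ ((pointEquivClosedPoint f).symm ⟨y, hyc⟩).2
  -- Undoing the translation by $x$ and then translating by $y$ gives an automorphism over the field
  -- that carries $x$ to $y$. It preserves the smooth locus, which contradicts the choice of $x$.
  let α := (GrpObj.mulRight (A := Over.mk f) x').symm ≪≫
    (GrpObj.mulRight (A := Over.mk f) y')
  have hα : x' ≫ α.hom = y' := by
    dsimp only [Iso.trans_hom, Iso.symm_hom, α]
    rw [← Category.assoc, ← Iso.eq_comp_inv]
    simp [comp_lift_assoc]
  let φ : G ⟶ G := α.hom.left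
  have hφf : φ ≫ f = f := Over.w α.hom
  have : IsIso φ := inferInstanceAs (IsIso ((Over.forget _).map α.hom))
  have hx' : x'.left (IsLocalRing.closedPoint K) = x :=
    pointOfClosedPoint_apply f x _ _
  have hy' : y'.left (IsLocalRing.closedPoint K) = y :=
    pointOfClosedPoint_apply f y _ _
  have hφ : φ x = y := by
    rw [← hx', ← hy', ← hα]
    rfl
  have hpre : φ ⁻¹ᵁ f.smoothLocus = f.smoothLocus := by
    have h := Scheme.Hom.preimage_smoothLocus_eq φ f
    simpa only [hφf] using h
  refine hx ?_
  rw [← hφ] at hy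
  have h : x ∈ φ ⁻¹ᵁ f.smoothLocus := hy
  rwa [hpre] at h

/-! ### Smoothness of `G` over the complex numbers. -/

section Smooth

variable {n : ℕ} (G : Subgroup (Matrix.SpecialLinearGroup (Fin n) ℂ))

/-- The ring of regular functions on `G`. -/
abbrev GroupRing : Type := MvPolynomial (Fin n × Fin n) ℂ ⧸ groupIdeal G

theorem ker_mkₐ_groupIdeal :
    RingHom.ker (Ideal.Quotient.mkₐ ℂ (groupIdeal G)) = groupIdeal G :=
  Ideal.mk_ker

theorem isMatrixGroup_groupIdeal : IsMatrixGroup (groupIdeal G) where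
  one := isPoint_one
  mul := IsPoint.mul
  adjugate := IsPoint.adjugate
  det := IsPoint.det_eq_one

instance : _root_.IsReduced (GroupRing G) := by
  rw [← Ideal.isRadical_iff_quotient_reduced]
  rintro p ⟨k, hk⟩
  rw [mem_groupIdeal] at hk ⊢
  intro g hg
  have h := hk g hg
  rw [map_pow] at h
  exact _root_.IsReduced.eq_zero _ ⟨k, h⟩

/-- The points of `groupIdeal G` form groups of matrices, so the spectrum is a group scheme. It is
reduced and of finite type over $\mathbb C$, hence smooth by translation. -/
instance : Algebra.FormallySmooth ℂ (GroupRing G) := by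
  obtain ⟨_, -⟩ := exists_grpObj (Ideal.Quotient.mkₐ ℂ (groupIdeal G))
    Ideal.Quotient.mk_surjective (by
      rw [ker_mkₐ_groupIdeal]
      exact isMatrixGroup_groupIdeal G)
  have hft : LocallyOfFiniteType
      (Spec.map (CommRingCat.ofHom (algebraMap ℂ (GroupRing G)))) := by
    rw [HasRingHomProperty.Spec_iff (P := @LocallyOfFiniteType)]
    exact (RingHom.finiteType_algebraMap).2 inferInstance
  have hs := smooth_of_grpObj_of_isAlgClosed
    (Spec.map (CommRingCat.ofHom (algebraMap ℂ (GroupRing G))))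
  rw [HasRingHomProperty.Spec_iff (P := @Smooth)] at hs
  exact (RingHom.smooth_algebraMap.1 hs).formallySmooth

variable {G} {P : Fin n → Fin n → MvPolynomial (Fin n × Fin n) ℂ} {θ : G →* G}

/-- Points of `G` lift along surjections with square zero kernel. -/
theorem IsPoint.exists_lift {B : Type} [CommRing B] (I : Ideal B) (hI : I ^ 2 = ⊥) (c : ℂ →+* B)
    {M : Matrix (Fin n) (Fin n) (B ⧸ I)}
    (hM : IsPoint ((Ideal.Quotient.mk I).comp c) (groupIdeal G) M) :
    ∃ N : Matrix (Fin n) (Fin n) B, IsPoint c (groupIdeal G) N ∧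
      N.map (Ideal.Quotient.mk I) = M := by
  let := c.toAlgebra
  rw [← ker_mkₐ_groupIdeal] at hM
  obtain ⟨φ, hφ, rfl⟩ := IsPoint.exists_ringHom _ Ideal.Quotient.mk_surjective hM
  let φ' : GroupRing G →ₐ[ℂ] B ⧸ I := { φ with commutes' := RingHom.congr_fun hφ }
  obtain ⟨ψ, hψ⟩ := Algebra.FormallySmooth.comp_surjective ℂ (GroupRing G) I hI φ'
  refine ⟨(generatorMatrix (Ideal.Quotient.mkₐ ℂ (groupIdeal G))).map ψ, ?_, ?_⟩
  · have h := isPoint_generatorMatrix_map (Ideal.Quotient.mkₐ ℂ (groupIdeal G)) (ρ := c)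
      (ψ : GroupRing G →+* B) (RingHom.ext ψ.commutes)
    rwa [ker_mkₐ_groupIdeal] at h
  · ext i j
    exact AlgHom.congr_fun hψ _

end Smooth

/-! ### Smoothness of the family by faithfully flat descent. -/

section SmoothFamily

open scoped TensorProduct

variable {n : ℕ} {G : Subgroup (Matrix.SpecialLinearGroup (Fin n) ℂ)}
  {P : Fin n → Fin n → MvPolynomial (Fin n × Fin n) ℂ} {θ : G →* G}

/-- The point untwists to a point of $G$ over $B/I$. This lifts by formal smoothness of $G$ and is
twisted back with the given root $w$, which already lives in $B$. -/
theorem IsPoint.exists_lift_family (hθ : Function.Involutive θ) (hP : Represents P θ)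
    {B : Type} [CommRing B] (I : Ideal B) (hI : I ^ 2 = ⊥) (ρ : ℂ[T;T⁻¹] →+* B) (w : Bˣ)
    (hw : ρ (LaurentPolynomial.T 1) = (w ^ 2 : Bˣ))
    {x : Matrix (Fin n ⊕ Fin n) (Fin n ⊕ Fin n) (B ⧸ I)}
    (hx : IsPoint ((Ideal.Quotient.mk I).comp ρ) (equations (totalSet θ)) x) :
    ∃ y : Matrix (Fin n ⊕ Fin n) (Fin n ⊕ Fin n) B, IsPoint ρ (equations (totalSet θ)) y ∧
      y.map (Ideal.Quotient.mk I) = x := by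
  have hρ := eq_eval₂ ρ (w ^ 2) hw
  rw [hρ, comp_eval₂, map_pow] at hx
  obtain ⟨M, hM, rfl⟩ := hx.exists_eq_twist hθ hP
  obtain ⟨N, hN, rfl⟩ := hM.exists_lift I hI
  refine ⟨GroupFamily.twist (ρ.comp LaurentPolynomial.C) w N
    (GroupFamily.applyPoly P (ρ.comp LaurentPolynomial.C) N), ?_, ?_⟩
  · have h := hN.twist hθ hP w
    rwa [← hρ] at h
  · rw [twist_map, applyPoly_map]

instance (E : Set (ℂˣ × Matrix.SpecialLinearGroup (Fin n ⊕ Fin n) ℂ)) :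
    Algebra.FiniteType ℂ[T;T⁻¹] (CoordRing E) :=
  .of_surjective (coordMap E) (coordMap_surjective E)

/-- Noetherianity upgrades finite type to finite presentation, which smoothness requires. -/
instance : IsNoetherianRing ℂ[T;T⁻¹] :=
  IsLocalization.isNoetherianRing (.powers (Polynomial.X : Polynomial ℂ)) _ inferInstance

/-- The extension $S=\mathbb C[T,T^{-1}][\sqrt T]$ is free and nontrivial, hence faithfully flat, so
smoothness may be checked after base change to $S$. There it amounts to lifting points over
$S$-algebras. -/
theorem smooth_coordRing (hθ : Function.Involutive θ) (hP : Represents P θ) :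
    Algebra.Smooth ℂ[T;T⁻¹] (CoordRing (totalSet θ)) := by
  let S := SqrtRing unitT.1
  have hfp : Algebra.FinitePresentation ℂ[T;T⁻¹] (CoordRing (totalSet θ)) :=
    Algebra.FinitePresentation.of_finiteType.1 inferInstance
  have hnt : Nontrivial S := (algebraMap_sqrtRing_injective unitT.1).nontrivial
  have hff : Module.FaithfullyFlat ℂ[T;T⁻¹] S := inferInstance
  have hfs : Algebra.FormallySmooth S (S ⊗[ℂ[T;T⁻¹]] CoordRing (totalSet θ)) := by
    refine .of_comp_surjective fun B _ _ I hI f => ?_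
    let ρ : ℂ[T;T⁻¹] →+* B := (algebraMap S B).comp (algebraMap ℂ[T;T⁻¹] S)
    let : Algebra ℂ[T;T⁻¹] B := ρ.toAlgebra
    have : IsScalarTower ℂ[T;T⁻¹] S B := .of_algebraMap_eq fun _ => rfl
    -- Being an $S$-algebra, $B$ carries a chosen square root of $T$.
    let w : Bˣ := Units.map (algebraMap S B : S →* B) (rootUnit unitT)
    have hw : ρ (LaurentPolynomial.T 1) = (w ^ 2 : Bˣ) := by
      have h := congrArg (algebraMap S B) (root_sq unitT.1)
      rw [map_pow] at h
      exact h.symm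
    let f₀ := (f.restrictScalars ℂ[T;T⁻¹]).comp
      (Algebra.TensorProduct.includeRight (R := ℂ[T;T⁻¹]) (A := S) (B := CoordRing (totalSet θ)))
    have hx := isPoint_generatorMatrix_map (coordMap (totalSet θ))
      (ρ := (Ideal.Quotient.mk I).comp ρ)
      (f₀ : CoordRing (totalSet θ) →+* B ⧸ I) (RingHom.ext f₀.commutes)
    obtain ⟨y, hy, hyx⟩ := IsPoint.exists_lift_family hθ hP I hI ρ w hw hx
    obtain ⟨φ, hφ, hφy⟩ := IsPoint.exists_ringHom _ (coordMap_surjective _) hy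
    let φ' : CoordRing (totalSet θ) →ₐ[ℂ[T;T⁻¹]] B := { φ with commutes' := RingHom.congr_fun hφ }
    -- An $S$-algebra map out of the base change is determined by its restriction to the coordinate
    -- ring, so the lifted matrix `y` determines the required lift.
    refine ⟨Algebra.TensorProduct.lift (Algebra.ofId S B) φ' fun _ _ => Commute.all _ _, ?_⟩
    have h : (Ideal.Quotient.mk I).comp φ = (f₀ : CoordRing (totalSet θ) →+* B ⧸ I) := by
      refine ringHom_ext_generatorMatrix _ (coordMap_surjective _) ?_ ?_
      · rw [RingHom.comp_assoc, hφ]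
        exact (RingHom.ext f₀.commutes).symm
      · rw [← hyx, ← hφy]
        rfl
    refine Algebra.TensorProduct.ext (Subsingleton.elim _ _) (AlgHom.ext fun a => ?_)
    have h2 := RingHom.congr_fun h a
    change Ideal.Quotient.mk I (Algebra.TensorProduct.lift (Algebra.ofId S B) φ'
      (fun _ _ => Commute.all _ _) (1 ⊗ₜ a)) = _
    rw [Algebra.TensorProduct.lift_tmul, map_one, one_mul]
    exact h2
  have hs : Algebra.Smooth S (S ⊗[ℂ[T;T⁻¹]] CoordRing (totalSet θ)) := ⟨hfs, inferInstance⟩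
  exact Algebra.Smooth.of_smooth_tensorProduct_of_faithfullyFlat S

theorem isReduced_coordRing {m : Type} [Fintype m] [DecidableEq m]
    (E : Set (ℂˣ × Matrix.SpecialLinearGroup m ℂ)) : _root_.IsReduced (CoordRing E) := by
  rw [← Ideal.isRadical_iff_quotient_reduced]
  rintro p ⟨k, hk⟩
  rw [mem_vanishingIdeal] at hk ⊢
  intro g hg
  have h := hk g hg
  rw [map_pow] at h
  exact _root_.IsReduced.eq_zero _ ⟨k, h⟩

theorem isMatrixGroup_equations (hθ : Function.Involutive θ) (hP : Represents P θ) :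
    IsMatrixGroup (equations (totalSet θ)) where
  one := isPoint_equations_one hθ hP
  mul := IsPoint.mul_family hθ hP
  adjugate := IsPoint.adjugate_family hθ hP
  det := isPoint_family_det_eq_one

theorem isFamilyOfMatrixGroups_totalSet (hθ : Function.Involutive θ) (hP : Represents P θ) :
    IsFamilyOfMatrixGroups (totalSet θ) := by
  obtain ⟨i, hi⟩ := exists_grpObj (coordMap (totalSet θ)) (coordMap_surjective _)
    (isMatrixGroup_equations hθ hP)
  have hgen : generatorMatrix (coordMap (totalSet θ)) = Matrix.of (entry (totalSet θ)) := by
    ext i j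
    simp only [generatorMatrix, Matrix.map_apply, Matrix.mvPolynomialX_apply]
    rfl
  rw [hgen] at hi
  refine ⟨i, @IsAlgebraicFamilyOfGroups.mk _ (asScheme (totalSet θ)) i ?_ ?_ ?_ ?_ ?_, hi⟩
  · change Smooth (Spec.map _)
    rw [HasRingHomProperty.Spec_iff (P := @Smooth)]
    exact RingHom.smooth_algebraMap.2 (smooth_coordRing hθ hP)
  · change IsSeparated (Spec.map _)
    infer_instance
  · change LocallyOfFiniteType (Spec.map _)
    rw [HasRingHomProperty.Spec_iff (P := @LocallyOfFiniteType)]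
    exact RingHom.finiteType_algebraMap.2 inferInstance
  · change QuasiCompact (Spec.map _)
    infer_instance
  · have := isReduced_coordRing (totalSet θ)
    change AlgebraicGeometry.IsReduced (Spec _)
    infer_instance

end SmoothFamily

end GroupFamily

end

theorem proposition3p2 {n : ℕ} (G : Subgroup (Matrix.SpecialLinearGroup (Fin n) ℂ))
    (hG : GroupFamily.IsAlgebraicSubgroup G) (θ : G →* G)
    (hθ : GroupFamily.IsAlgebraicInvolution θ) :
    GroupFamily.IsClosedSubvariety (GroupFamily.totalSet θ) ∧
      GroupFamily.IsFamilyOfMatrixGroups (GroupFamily.totalSet θ) := by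
  obtain ⟨P, hP⟩ := hθ.regular
  exact ⟨GroupFamily.isClosedSubvariety_totalSet hG hθ.involutive hP,
    GroupFamily.isFamilyOfMatrixGroups_totalSet hθ.involutive hP⟩
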